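/- Let $\Omega\subset\mathbb{R}^3$ be a bounded open set, let $\mathcal S_0$ be the space of symmetric traceless real $3\times3$ matrices with the Frobenius norm, and let $A<0$, $B,C,\lambda,\omega_p,\omega_a,\omega_v>0$. Put $W(s)=s^2(1-s)^2$, $\Phi(s)=\int_0^s\sqrt{W(t)}\,dt$, $s_+=\frac{B+\sqrt{B^2-24AC}}{4C}$ and $$\bar F_b(\mathbf Q)=\frac1C\Big[\frac A2\operatorname{tr}\mathbf Q^2-\frac B3\operatorname{tr}\mathbf Q^3+\frac C4(\operatorname{tr}\mathbf Q^2)^2\Big].$$ Let $H_0^1$ be the closure of the smooth functions with compact support in $\Omega$ in the $H^1$ norm. For $\varepsilon>0$, $\mathbf Q\in H_0^1(\Omega;\mathcal S_0)$ and $\phi\in H_0^1(\Omega)$ define $$E^{\rm LdG}[\mathbf Q]=\int_\Omega\Big[\tfrac12|\nabla\mathbf Q|^2+\lambda^2\bar F_b(\mathbf Q)\Big]dx,\qquad E^{\rm mix}_\varepsilon[\phi]=\int_\Omega\Big[\varepsilon|\nabla\phi|^2+\varepsilon^{-1}W(\phi)\Big]dx,$$ $$E^{\rm anch}_\varepsilon[\mathbf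 Q,\phi]=\int_\Omega\varepsilon\Big|\Big(\mathbf Q+\frac{s_+}3\mathbf I\Big)\nabla\phi\Big|^2dx,\qquad E^{\rm void}[\mathbf Q,\phi]=\int_\Omega\tfrac12(1-\phi)^2|\mathbf Q|^2dx,$$ and $E_\varepsilon=E^{\rm LdG}+\omega_p\lambda E^{\rm mix}_\varepsilon+\omega_a\lambda E^{\rm anch}_\varepsilon+\omega_v\lambda^2E^{\rm void}$ (the value $+\infty$ is allowed). Let $\varepsilon_n>0$ with $\varepsilon_n\to0$, and let $\mathbf Q_n\in H_0^1(\Omega;\mathcal S_0)$ and $\phi_n\in H_0^1(\Omega)$ be arbitrary sequences. Precompactness of a sequence means that each of its subsequences has a further subsequence that converges in the stated sense. Then: (a) If $E^{\rm LdG}[\mathbf Q_n]$ is bounded above uniformly in $n$, then $\{\mathbf Q_n\}$ is weakly precompact in $H_0^1(\Omega;\mathcal S_0)$. (b) If $E^{\rm mix}_{\varepsilon_n}[\phi_n]$ is bounded uniformly in $n$, then $\{\phi_n\}$ is precompact in $L^1(\Omega)$, and every $L^1$ limit of a subsequence takes only the values $0$ and $1$ almost everywhere. (c) If $E^{\rm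 mix}_{\varepsilon_n}[\phi_n]$ and $E^{\rm anch}_{\varepsilon_n}[\mathbf Q_n,\phi_n]$ are bounded uniformly in $n$, then the distributional gradients $\nabla\Phi(\phi_n)$ and the products $\mathbf Q_n\nabla\Phi(\phi_n)$ are integrable functions on $\Omega$, and the two sequences of $\mathbb{R}^3$-valued measures $\nabla\Phi(\phi_n)\,dx$ and $\mathbf Q_n\nabla\Phi(\phi_n)\,dx$ are weak-$*$ precompact as Radon measures on $\Omega$. Here $\mu_n\overset{*}{\rightharpoonup}\mu$ means $\int_\Omega f\,d\mu_n\to\int_\Omega f\,d\mu$ for all continuous $f$ with compact support in $\Omega$ (in particular for all $f\in C_c^\infty(\Omega)$), and the limits are $\mathbb{R}^3$-valued measures on $\Omega$ of finite total variation. In particular, if $E_{\varepsilon_n}[\mathbf Q_n,\phi_n]$ is bounded above uniformly in $n$, then the conclusions of (a), (b) and (c) all hold. -/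

import Mathlib

open MeasureTheory Filter Topology TopologicalSpace
open scoped ENNReal Matrix Distributions

noncomputable section

namespace LdG

/-- Euclidean space `ℝ³`. -/
abbrev E3 := EuclideanSpace ℝ (Fin 3)

/-- The space `𝒮₀` of symmetric traceless real `3 × 3` matrices. It is realised as a subspace of
`ℝ^(3 × 3)` with its Euclidean structure, so that the norm is the Frobenius norm. -/
def S0 : Submodule ℝ (EuclideanSpace ℝ (Fin 3 × Fin 3)) where
  carrier := {q | (∀ i j, q (i, j) = q (j, i)) ∧ ∑ i, q (i, i) = 0}
  add_mem' := by
    rintro p q ⟨hp, hp'⟩ ⟨hq, hq'⟩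
    refine ⟨fun i j => ?_, ?_⟩
    · simp [hp i j, hq i j]
    · simp [Finset.sum_add_distrib, hp', hq']
  zero_mem' := by simp
  smul_mem' := by
    rintro c q ⟨hq, hq'⟩
    refine ⟨fun i j => ?_, ?_⟩
    · simp [hq i j]
    · simp [← Finset.mul_sum, hq']

/-- An element of `𝒮₀` as a matrix. -/
def toMat (q : S0) : Matrix (Fin 3) (Fin 3) ℝ :=
  Matrix.of fun i j => (q : EuclideanSpace ℝ (Fin 3 × Fin 3)) (i, j)

/-- The action of a `3 × 3` matrix on a vector of `ℝ³`. -/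
def matVec (M : Matrix (Fin 3) (Fin 3) ℝ) (v : E3) : E3 := WithLp.toLp 2 (M *ᵥ v.ofLp)

/-! ### Sobolev spaces -/

section Sobolev

variable (Ω : Opens E3) (V : Type) [NormedAddCommGroup V] [InnerProductSpace ℝ V]

/-- Lebesgue measure on `Ω`. -/
abbrev vol : Measure E3 := volume.restrict (Ω : Set E3)

/-- Gradients of `V`-valued functions: triples `(∂₁u, ∂₂u, ∂₃u)` with the Euclidean (`ℓ²`) norm.
For `V = ℝ` this is `ℝ³`. -/
abbrev Grad := PiLp 2 (fun _ : Fin 3 => V)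

variable {V} in
/-- The classical gradient of a function on `ℝ³`. -/
def classicalGrad (f : E3 → V) (x : E3) : Grad V :=
  WithLp.toLp 2 fun k => fderiv ℝ f x (EuclideanSpace.single k 1)

/-- The Hilbert space of pairs `(u, g)` with `u ∈ L²(Ω; V)` and `g ∈ L²(Ω; V³)`, whose inner
product is `∫ u · v + ∫ g · h`. -/
abbrev PairSpace := WithLp 2 (Lp V 2 (vol Ω) × Lp (Grad V) 2 (vol Ω))

/-- The pairs `(f, ∇f)` with `f ∈ C_c^∞(Ω; V)`. -/
def testPairs : Submodule ℝ (PairSpace Ω V) where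
  carrier := {p | ∃ f : 𝓓(Ω, V), p.fst =ᵐ[vol Ω] (f : E3 → V) ∧
    p.snd =ᵐ[vol Ω] classicalGrad (f : E3 → V)}
  add_mem' := by
    rintro p q ⟨f, hf, hf'⟩ ⟨g, hg, hg'⟩
    refine ⟨f + g, ?_, ?_⟩
    · refine (Lp.coeFn_add p.fst q.fst).trans ?_
      filter_upwards [hf, hg] with x h1 h2
      simp [h1, h2]
    · refine (Lp.coeFn_add p.snd q.snd).trans ?_
      filter_upwards [hf', hg'] with x h1 h2
      have h3 : fderiv ℝ ((f + g : 𝓓(Ω, V)) : E3 → V) x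
          = fderiv ℝ (f : E3 → V) x + fderiv ℝ (g : E3 → V) x :=
        fderiv_add (f.contDiff.differentiable (by simp) x) (g.contDiff.differentiable (by simp) x)
      ext k
      simp only [Pi.add_apply, h1, h2, classicalGrad, h3, PiLp.add_apply, _root_.add_apply]
  zero_mem' := by
    refine ⟨0, ?_, ?_⟩
    · exact (Lp.coeFn_zero V 2 (vol Ω)).trans (by simp)
    · refine (Lp.coeFn_zero (Grad V) 2 (vol Ω)).trans (Eventually.of_forall fun x => ?_)
      ext k
      simp [classicalGrad]
  smul_mem' := by
    rintro c p ⟨f, hf, hf'⟩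
    refine ⟨c • f, ?_, ?_⟩
    · refine (Lp.coeFn_smul c p.fst).trans ?_
      filter_upwards [hf] with x h1
      simp [h1]
    · refine (Lp.coeFn_smul c p.snd).trans ?_
      filter_upwards [hf'] with x h1
      have h3 : fderiv ℝ ((c • f : 𝓓(Ω, V)) : E3 → V) x = c • fderiv ℝ (f : E3 → V) x :=
        fderiv_const_smul (f.contDiff.differentiable (by simp) x) c
      ext k
      simp only [Pi.smul_apply, h1, classicalGrad, h3, PiLp.smul_apply, _root_.smul_apply]

/-- The Sobolev space `H₀¹(Ω; V)`: the closure of `C_c^∞(Ω; V)` in the `H¹` norm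
`(∫ |u|² + |∇u|²)^(1/2)`. An element is recorded as the pair of `u` and its weak gradient. -/
def H10 : Submodule ℝ (PairSpace Ω V) := (testPairs Ω V).topologicalClosure

variable {Ω V}

/-- The function underlying an element of `H₀¹(Ω; V)`. -/
def fn (u : H10 Ω V) : E3 → V := (u : PairSpace Ω V).fst

/-- The weak gradient of an element of `H₀¹(Ω; V)`. -/
def wgrad (u : H10 Ω V) : E3 → Grad V := (u : PairSpace Ω V).snd

variable (Ω) in
/-- `g` is the gradient of the scalar function `u` on `Ω` in the sense of distributions. -/
def HasWeakGradient (u : E3 → ℝ) (g : E3 → E3) : Prop :=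
  LocallyIntegrableOn u (Ω : Set E3) ∧ LocallyIntegrableOn g (Ω : Set E3) ∧
    ∀ (ψ : 𝓓(Ω, ℝ)) (k : Fin 3),
      ∫ x in (Ω : Set E3), u x * classicalGrad (ψ : E3 → ℝ) x k
        = -∫ x in (Ω : Set E3), g x k * ψ x

end Sobolev

/-! ### The energies -/

section Energy

variable {Ω : Opens E3}

/-- The double well `W(s) = s² (1 - s)²`. -/
def W (s : ℝ) : ℝ := s ^ 2 * (1 - s) ^ 2

/-- `Φ(s) = ∫₀ˢ √W`. -/
def Phi (s : ℝ) : ℝ := ∫ t in (0 : ℝ)..s, √(W t)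

/-- `s₊ = (B + √(B² - 24 A C)) / (4 C)`. -/
def sPlus (A B C : ℝ) : ℝ := (B + √(B ^ 2 - 24 * A * C)) / (4 * C)

/-- The rescaled bulk energy density
`C⁻¹ ((A/2) tr Q² - (B/3) tr Q³ + (C/4) (tr Q²)²)`. -/
def bulk (A B C : ℝ) (q : S0) : ℝ :=
  C⁻¹ * (A / 2 * (toMat q ^ 2).trace - B / 3 * (toMat q ^ 3).trace
    + C / 4 * (toMat q ^ 2).trace ^ 2)

/-- The Landau-de Gennes energy `∫_Ω ½ |∇Q|² + λ² F_b(Q)`. On a bounded `Ω ⊆ ℝ³` the integrand is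
integrable for every `Q ∈ H₀¹(Ω; 𝒮₀)`, because `H₀¹` embeds into `L⁴`. -/
def energyLdG (A B C lam : ℝ) (Q : H10 Ω S0) : ℝ :=
  ∫ x in (Ω : Set E3), (1 / 2 * ‖wgrad Q x‖ ^ 2 + lam ^ 2 * bulk A B C (fn Q x))

/-- The mixing energy `∫_Ω ε |∇φ|² + ε⁻¹ W(φ)`. -/
def energyMix (ε : ℝ) (φ : H10 Ω ℝ) : ℝ≥0∞ :=
  ∫⁻ x in (Ω : Set E3), ENNReal.ofReal (ε * ‖wgrad φ x‖ ^ 2 + ε⁻¹ * W (fn φ x))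

/-- The anchoring energy `∫_Ω ε |(Q + (s₊/3) I) ∇φ|²`, possibly infinite. -/
def energyAnch (A B C ε : ℝ) (Q : H10 Ω S0) (φ : H10 Ω ℝ) : ℝ≥0∞ :=
  ∫⁻ x in (Ω : Set E3), ENNReal.ofReal
    (ε * ‖matVec (toMat (fn Q x) + (sPlus A B C / 3) • 1) (wgrad φ x)‖ ^ 2)

/-- The void energy `∫_Ω ½ (1 - φ)² |Q|²`. -/
def energyVoid (Q : H10 Ω S0) (φ : H10 Ω ℝ) : ℝ≥0∞ :=
  ∫⁻ x in (Ω : Set E3), ENNReal.ofReal (1 / 2 * (1 - fn φ x) ^ 2 * ‖fn Q x‖ ^ 2)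

/-- The total diffuse-interface energy
`E^LdG + ω_p λ E^mix + ω_a λ E^anch + ω_v λ² E^void`, possibly `+∞`. -/
def energy (A B C lam ωp ωa ωv ε : ℝ) (Q : H10 Ω S0) (φ : H10 Ω ℝ) : EReal :=
  (energyLdG A B C lam Q : EReal)
    + ((ENNReal.ofReal (ωp * lam) * energyMix ε φ
      + ENNReal.ofReal (ωa * lam) * energyAnch A B C ε Q φ
      + ENNReal.ofReal (ωv * lam ^ 2) * energyVoid Q φ : ℝ≥0∞) : EReal)

end Energy

/-! ### Notions of precompactness of a sequence

Every subsequence has a further subsequence that converges. -/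

section Compactness

variable (Ω : Opens E3)

/-- Weak (sequential) precompactness in `H₀¹(Ω; V)`. -/
def WeaklyPrecompact {V : Type} [NormedAddCommGroup V] [InnerProductSpace ℝ V]
    (Q : ℕ → H10 Ω V) : Prop :=
  ∀ j : ℕ → ℕ, StrictMono j → ∃ k : ℕ → ℕ, StrictMono k ∧ ∃ Q' : H10 Ω V,
    Tendsto (fun n => toWeakSpace ℝ (H10 Ω V) (Q (j (k n)))) atTop
      (𝓝 (toWeakSpace ℝ (H10 Ω V) Q'))

/-- `uₙ → u` in `L¹(Ω)`. -/
def TendstoL1 (u : ℕ → E3 → ℝ) (u' : E3 → ℝ) : Prop :=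
  MemLp u' 1 (vol Ω) ∧ Tendsto (fun n => eLpNorm (fun x => u n x - u' x) 1 (vol Ω)) atTop (𝓝 0)

/-- Precompactness in `L¹(Ω)`. -/
def PrecompactL1 (u : ℕ → E3 → ℝ) : Prop :=
  ∀ j : ℕ → ℕ, StrictMono j → ∃ k : ℕ → ℕ, StrictMono k ∧ ∃ u' : E3 → ℝ,
    TendstoL1 Ω (fun n => u (j (k n))) u'

/-- Every cluster point in `L¹(Ω)` of the sequence `u` is a.e. equal to `0` or `1`. -/
def ClusterPointsBinary (u : ℕ → E3 → ℝ) : Prop :=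
  ∀ k : ℕ → ℕ, StrictMono k → ∀ u' : E3 → ℝ, TendstoL1 Ω (fun n => u (k n)) u' →
    ∀ᵐ x ∂(vol Ω), u' x = 0 ∨ u' x = 1

/-- Weak-`*` convergence on `Ω` of `ℝ³`-valued measures: convergence of the integrals of continuous
functions with compact support in `Ω`. -/
def WeakStarTendsto (μ : ℕ → VectorMeasure E3 E3) (ν : VectorMeasure E3 E3) : Prop :=
  ∀ f : E3 → ℝ, Continuous f → HasCompactSupport f → tsupport f ⊆ (Ω : Set E3) →
    Tendsto (fun n => ∫ᵛ x, f x ∂•(μ n)) atTop (𝓝 (∫ᵛ x, f x ∂•ν))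

/-- Weak-`*` precompactness as Radon measures on `Ω` (`ℝ³`-valued, of finite total variation and
concentrated on `Ω`). -/
def WeakStarPrecompact (μ : ℕ → VectorMeasure E3 E3) : Prop :=
  ∀ j : ℕ → ℕ, StrictMono j → ∃ k : ℕ → ℕ, StrictMono k ∧ ∃ ν : VectorMeasure E3 E3,
    IsFiniteMeasure ν.variation ∧ ν.restrict (Ω : Set E3) = ν ∧
      WeakStarTendsto Ω (fun n => μ (j (k n))) ν

variable {Ω}

/-- `∇Φ(φₙ)` and `Qₙ ∇Φ(φₙ)` are integrable functions on `Ω`, where `∇` is the distributional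
gradient, and the vector measures `∇Φ(φₙ) dx` and `Qₙ ∇Φ(φₙ) dx` are weak-`*` precompact. -/
def GradPhiPrecompact (Q : ℕ → H10 Ω S0) (φ : ℕ → H10 Ω ℝ) : Prop :=
  ∃ G : ℕ → E3 → E3,
    (∀ n, HasWeakGradient Ω (fun x => Phi (fn (φ n) x)) (G n)
      ∧ Integrable (G n) (vol Ω)
      ∧ Integrable (fun x => matVec (toMat (fn (Q n) x)) (G n x)) (vol Ω))
    ∧ WeakStarPrecompact Ω (fun n => (vol Ω).withDensityᵥ (G n))
    ∧ WeakStarPrecompact Ω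
        (fun n => (vol Ω).withDensityᵥ (fun x => matVec (toMat (fn (Q n) x)) (G n x)))

end Compactness

end LdG

end

/-!
The three parts rest on different mechanisms.

*Weak compactness of the tensors.* The quartic term of the bulk density dominates the others, so
that the density is at least `‖Q‖² - K` (`exists_le_bulk`). The Landau-de Gennes energy therefore
controls the `H¹` norm on the bounded set `Ω`; its integrand is integrable because `H₀¹` embeds into
`L⁴`. Bounded sequences of the separable Hilbert space `H₀¹` are weakly precompact
(`weaklyPrecompact_of_integral_le`). Since the bulk energy is bounded below and the other energies
are nonnegative, a bound on the total energy bounds each part (`exists_bounds_of_energy_le`).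

*Compactness of the phase fields* (the argument of Modica and Mortola). By Young's inequality
`|∇Φ(φ)| = √W(φ) |∇φ|` is at most the mixing energy density. Hence `Φ(φₙ)` is bounded in `W^{1,1}`
and, after approximation by test functions (`exists_testFunction_Phi_close`), Rellich's theorem
gives an `L¹` convergent subsequence (`exists_subseq_tendsto_of_lintegral_fderiv_le`). As
`Φ(0) = 0` and `Φ(1) = 1/6`, the function `s - 6 Φ(s)` vanishes at both wells and is bounded by
`3 (√W(s) + W(s))` (`abs_sub_six_mul_Phi_le`). Since `∫ W(φₙ)` tends to zero, `φₙ - 6 Φ(φₙ)` tends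
to zero in `L¹`, and `φₙ` converges along the same subsequence; the same limit shows that `W`
vanishes at every cluster point.

*Weak-`*` compactness of the fields.* The chain rule `∇Φ(φ) = √W(φ) ∇φ` holds in `H₀¹` because `√W`
and `Φ` grow at most like the second and the third power, which the `L⁴` convergence of the
approximating test functions can handle (`hasWeakGradient_gradPhi`). Writing
`Q ∇Φ(φ) = √W(φ) (Q + s₊/3) ∇φ - (s₊/3) ∇Φ(φ)`, Young's inequality bounds both fields in `L¹`
(`lintegral_gradPhi_le_energyMix`, `lintegral_matVec_gradPhi_le`). Finally, sequences bounded in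
`L¹` are weak-`*` precompact as measures (`weakStarPrecompact_of_lintegral_le`): Prokhorov's theorem
applies to the positive and negative parts of the coordinates, and the limits are assembled into one
vector measure through their densities.
-/

namespace LdG

/-! ### The bulk energy density -/

lemma abs_entry_le (q : S0) (i j : Fin 3) :
    |(q : EuclideanSpace ℝ (Fin 3 × Fin 3)) (i, j)| ≤ ‖q‖ :=
  PiLp.norm_apply_le (q : EuclideanSpace ℝ (Fin 3 × Fin 3)) (i, j)

lemma trace_toMat_sq (q : S0) : (toMat q ^ 2).trace = ‖q‖ ^ 2 := by
  have h : ‖q‖ ^ 2 = ∑ p : Fin 3 × Fin 3, (q : EuclideanSpace ℝ (Fin 3 × Fin 3)) p ^ 2 := by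
    rw [Submodule.coe_norm, EuclideanSpace.norm_sq_eq]
    simp
  rw [h, Fintype.sum_prod_type, pow_two, Matrix.trace]
  refine Finset.sum_congr rfl fun i _ => ?_
  rw [Matrix.diag_apply, Matrix.mul_apply]
  refine Finset.sum_congr rfl fun j _ => ?_
  simp only [toMat, Matrix.of_apply]
  rw [q.2.1 j i, pow_two]

lemma abs_trace_toMat_cube_le (q : S0) : |(toMat q ^ 3).trace| ≤ 27 * ‖q‖ ^ 3 := by
  have h : (toMat q ^ 3).trace = ∑ i, ∑ k, ∑ j, toMat q i j * toMat q j k * toMat q k i := by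
    simp only [pow_succ, pow_zero, one_mul, Matrix.trace, Matrix.diag_apply, Matrix.mul_apply,
      Finset.sum_mul]
  have key : ∀ i k j, |toMat q i j * toMat q j k * toMat q k i| ≤ ‖q‖ ^ 3 := fun i k j => by
    rw [abs_mul, abs_mul, pow_succ, pow_two]
    exact mul_le_mul (mul_le_mul (abs_entry_le q _ _) (abs_entry_le q _ _) (abs_nonneg _)
      (norm_nonneg _)) (abs_entry_le q _ _) (abs_nonneg _) (by positivity)
  rw [h]
  calc _ ≤ ∑ i : Fin 3, ∑ k : Fin 3, ∑ j : Fin 3, ‖q‖ ^ 3 := by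
        refine (Finset.abs_sum_le_sum_abs _ _).trans (Finset.sum_le_sum fun i _ => ?_)
        refine (Finset.abs_sum_le_sum_abs _ _).trans (Finset.sum_le_sum fun k _ => ?_)
        exact (Finset.abs_sum_le_sum_abs _ _).trans (Finset.sum_le_sum fun j _ => key i k j)
    _ = _ := by simp; ring

/-- The quartic term dominates: the bulk density controls `‖q‖²` up to an additive constant. -/
lemma exists_le_bulk (A B : ℝ) {C : ℝ} (hC : 0 < C) :
    ∃ K, 0 ≤ K ∧ ∀ q, ‖q‖ ^ 2 - K ≤ bulk A B C q := by
  set a := C⁻¹ * (A / 2)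
  set b := C⁻¹ * (|B| / 3 * 27)
  refine ⟨2 * (2 * b ^ 2 + |a| + 1) ^ 2, by positivity, fun q => ?_⟩
  have h3 : B / 3 * (toMat q ^ 3).trace ≤ |B| / 3 * 27 * ‖q‖ ^ 3 := by
    calc B / 3 * (toMat q ^ 3).trace ≤ |B / 3 * (toMat q ^ 3).trace| := le_abs_self _
      _ = |B| / 3 * |(toMat q ^ 3).trace| := by
        rw [abs_mul, abs_div, abs_of_pos (three_pos : (0 : ℝ) < 3)]
      _ ≤ |B| / 3 * (27 * ‖q‖ ^ 3) := by gcongr; exact abs_trace_toMat_cube_le q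
      _ = _ := by ring
  have h : a * ‖q‖ ^ 2 - b * ‖q‖ ^ 3 + 1 / 4 * ‖q‖ ^ 4 ≤ bulk A B C q := by
    have h' : C⁻¹ * (A / 2 * ‖q‖ ^ 2 - |B| / 3 * 27 * ‖q‖ ^ 3 + C / 4 * (‖q‖ ^ 2) ^ 2)
        ≤ bulk A B C q := by
      unfold bulk
      rw [trace_toMat_sq]
      gcongr
    refine le_trans (le_of_eq ?_) h'
    simp only [a, b]
    field_simp
  refine le_trans ?_ h
  set t := ‖q‖
  -- these two squares absorb the cubic term, then the quadratic one, into the quartic one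
  have h1 : 0 ≤ t ^ 2 * (t - 4 * b) ^ 2 := by positivity
  have h2 : 0 ≤ (t ^ 2 - 4 * (2 * b ^ 2 + |a| + 1)) ^ 2 := by positivity
  have h3 : -|a| * t ^ 2 ≤ a * t ^ 2 := by
    gcongr; exact neg_abs_le a
  nlinarith

lemma exists_abs_bulk_le (A B C : ℝ) : ∃ K, ∀ q, |bulk A B C q| ≤ K * (1 + ‖q‖ ^ 4) := by
  refine ⟨|C⁻¹| * (|A / 2| + |B / 3| * 27 + |C / 4|), fun q => ?_⟩
  have ht : 0 ≤ ‖q‖ := norm_nonneg q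
  have h2 : ‖q‖ ^ 2 ≤ 1 + ‖q‖ ^ 4 := by nlinarith [sq_nonneg (‖q‖ ^ 2 - 1)]
  have h3 : ‖q‖ ^ 3 ≤ 1 + ‖q‖ ^ 4 := by
    nlinarith [sq_nonneg (‖q‖ ^ 2 - 1), sq_nonneg (‖q‖ ^ 2 - ‖q‖)]
  have h3' : |(toMat q ^ 3).trace| ≤ 27 * (1 + ‖q‖ ^ 4) :=
    (abs_trace_toMat_cube_le q).trans (by gcongr)
  unfold bulk
  rw [trace_toMat_sq, abs_mul, mul_assoc]
  gcongr
  calc |A / 2 * ‖q‖ ^ 2 - B / 3 * (toMat q ^ 3).trace + C / 4 * (‖q‖ ^ 2) ^ 2|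
      ≤ |A / 2 * ‖q‖ ^ 2| + |B / 3 * (toMat q ^ 3).trace| + |C / 4 * (‖q‖ ^ 2) ^ 2| :=
        (abs_add_le _ _).trans (add_le_add_left (abs_sub _ _) _)
    _ = |A / 2| * ‖q‖ ^ 2 + |B / 3| * |(toMat q ^ 3).trace| + |C / 4| * ‖q‖ ^ 4 := by
        rw [abs_mul, abs_mul, abs_mul, abs_of_nonneg (by positivity : 0 ≤ ‖q‖ ^ 2),
          abs_of_nonneg (by positivity : 0 ≤ (‖q‖ ^ 2) ^ 2)]
        ring
    _ ≤ |A / 2| * (1 + ‖q‖ ^ 4) + |B / 3| * (27 * (1 + ‖q‖ ^ 4)) + |C / 4| * (1 + ‖q‖ ^ 4) := by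
        gcongr; linarith
    _ = _ := by ring

lemma continuous_toMat : Continuous toMat :=
  continuous_matrix fun i j => by
    simp only [toMat, Matrix.of_apply]
    fun_prop

lemma continuous_bulk (A B C : ℝ) : Continuous (bulk A B C) := by
  have := continuous_toMat
  unfold bulk
  fun_prop

lemma continuous_matVec :
    Continuous fun p : Matrix (Fin 3) (Fin 3) ℝ × E3 => matVec p.1 p.2 := by
  unfold matVec
  fun_prop

lemma matVec_add_smul_one (M : Matrix (Fin 3) (Fin 3) ℝ) (c : ℝ) (v : E3) :
    matVec (M + c • 1) v = matVec M v + c • v := by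
  ext i
  simp [matVec, Matrix.add_mulVec, Matrix.smul_mulVec]

lemma matVec_smul (M : Matrix (Fin 3) (Fin 3) ℝ) (c : ℝ) (v : E3) :
    matVec M (c • v) = c • matVec M v := by
  ext i
  simp [matVec, Matrix.mulVec_smul]

/-! ### The double well and its primitive -/

lemma W_nonneg (s : ℝ) : 0 ≤ W s := by unfold W; positivity

lemma continuous_W : Continuous W := by unfold W; fun_prop

lemma sqrt_W (s : ℝ) : √(W s) = |s * (1 - s)| := by
  rw [W, ← mul_pow, Real.sqrt_sq_eq_abs]

lemma continuous_sqrt_W : Continuous fun s => √(W s) := continuous_W.sqrt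

lemma W_eq_zero_iff {s : ℝ} : W s = 0 ↔ s = 0 ∨ s = 1 := by
  rw [W, mul_eq_zero, pow_eq_zero_iff two_ne_zero, pow_eq_zero_iff two_ne_zero, sub_eq_zero,
    eq_comm (a := 1)]

lemma sqrt_W_le (s : ℝ) : √(W s) ≤ (1 + |s|) ^ 2 := by
  rw [sqrt_W, abs_mul]
  have h : |1 - s| ≤ 1 + |s| := (abs_sub _ _).trans (by simp)
  nlinarith [abs_nonneg s, abs_nonneg (1 - s)]

lemma abs_sqrt_W_sub_le (a b : ℝ) :
    |√(W a) - √(W b)| ≤ |a - b| * (1 + |a| + |b|) := by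
  rw [sqrt_W, sqrt_W]
  refine (abs_abs_sub_abs_le _ _).trans ?_
  have : a * (1 - a) - b * (1 - b) = (a - b) * (1 - a - b) := by ring
  rw [this, abs_mul]
  gcongr
  exact (abs_sub _ _).trans (add_le_add_left ((abs_sub _ _).trans (by simp)) _)

lemma hasDerivAt_Phi (s : ℝ) : HasDerivAt Phi (√(W s)) s :=
  intervalIntegral.integral_hasDerivAt_right (continuous_sqrt_W.intervalIntegrable _ _)
    continuous_sqrt_W.stronglyMeasurable.stronglyMeasurableAtFilter
    continuous_sqrt_W.continuousAt

lemma contDiff_Phi : ContDiff ℝ 1 Phi := by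
  rw [contDiff_one_iff_deriv]
  refine ⟨fun s => (hasDerivAt_Phi s).differentiableAt, ?_⟩
  rw [funext fun s => (hasDerivAt_Phi s).deriv]
  exact continuous_sqrt_W

lemma continuous_Phi : Continuous Phi := contDiff_Phi.continuous

lemma Phi_zero : Phi 0 = 0 := by simp [Phi]

lemma abs_Phi_sub_le (a b : ℝ) : |Phi a - Phi b| ≤ |a - b| * (1 + |a| + |b|) ^ 2 := by
  have h : Phi a - Phi b = ∫ t in b..a, √(W t) :=
    intervalIntegral.integral_interval_sub_left (continuous_sqrt_W.intervalIntegrable _ _)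
      (continuous_sqrt_W.intervalIntegrable _ _)
  rw [h, mul_comm, ← Real.norm_eq_abs]
  refine intervalIntegral.norm_integral_le_of_norm_le_const fun t ht => ?_
  rw [Real.norm_of_nonneg (Real.sqrt_nonneg _)]
  refine (sqrt_W_le t).trans ?_
  have : |t| ≤ |a| + |b| := by
    rcases Set.mem_uIoc.1 ht with h | h <;>
    · rw [abs_le]
      constructor <;> linarith [neg_abs_le a, neg_abs_le b, le_abs_self a, le_abs_self b,
        abs_nonneg a, abs_nonneg b]
  exact pow_le_pow_left₀ (by positivity) (by linarith) 2

/-- The function `s - 6 Φ(s)` vanishes at both wells. -/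
lemma abs_sub_six_mul_Phi_le (s : ℝ) : |s - 6 * Phi s| ≤ 3 * (√(W s) + W s) := by
  -- an explicit primitive `P` of `√W` on each of the three intervals cut out by the wells
  have hP : ∀ a b : ℝ, (∫ t in a..b, t * (1 - t))
      = (b ^ 2 / 2 - b ^ 3 / 3) - (a ^ 2 / 2 - a ^ 3 / 3) := fun a b => by
    refine intervalIntegral.integral_eq_sub_of_hasDerivAt
      (f := fun t => t ^ 2 / 2 - t ^ 3 / 3) (fun t _ => ?_)
      (Continuous.intervalIntegrable (by fun_prop) _ _)
    refine (((hasDerivAt_pow 2 t).div_const 2).sub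
      ((hasDerivAt_pow 3 t).div_const 3)).congr_deriv ?_
    push_cast
    norm_num
    ring
  have hW : W s = (s * (1 - s)) ^ 2 := by rw [W]; ring
  have h01 : ∀ b : ℝ, 0 ≤ b → b ≤ 1 → Phi b = b ^ 2 / 2 - b ^ 3 / 3 := fun b h0 h1 => by
    have : Phi b = ∫ t in (0 : ℝ)..b, t * (1 - t) := by
      refine intervalIntegral.integral_congr fun t ht => ?_
      rw [Set.uIcc_of_le h0] at ht
      simp only [sqrt_W]
      rw [abs_of_nonneg (mul_nonneg ht.1 (by linarith [ht.2]))]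
    rw [this, hP]; ring
  rcases le_total s 0 with h0 | h0
  · have : Phi s = -(s ^ 2 / 2 - s ^ 3 / 3) := by
      have : Phi s = ∫ t in (0 : ℝ)..s, -(t * (1 - t)) := by
        refine intervalIntegral.integral_congr fun t ht => ?_
        rw [Set.uIcc_of_ge h0] at ht
        simp only [sqrt_W]
        rw [abs_of_nonpos (mul_nonpos_of_nonpos_of_nonneg ht.2 (by linarith [ht.2]))]
      rw [this, intervalIntegral.integral_neg, hP]; ring
    rw [this, sqrt_W, hW, abs_of_nonpos (mul_nonpos_of_nonpos_of_nonneg h0 (by linarith)), abs_le]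
    constructor <;>
    nlinarith [sq_nonneg s, mul_nonneg (neg_nonneg.2 h0) (sq_nonneg s), sq_nonneg (s ^ 2)]
  rcases le_total s 1 with h1 | h1
  · rw [h01 s h0 h1, sqrt_W, hW, abs_of_nonneg (mul_nonneg h0 (by linarith)), abs_le]
    have := mul_nonneg h0 (sub_nonneg.2 h1)
    constructor <;> nlinarith [sq_nonneg (s * (1 - s)), mul_nonneg this h0,
      mul_nonneg this (sub_nonneg.2 h1)]
  · have : Phi s = 1 / 3 - (s ^ 2 / 2 - s ^ 3 / 3) := by
      have h2 : Phi s = Phi 1 + ∫ t in (1 : ℝ)..s, √(W t) :=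
        (intervalIntegral.integral_add_adjacent_intervals
          (continuous_sqrt_W.intervalIntegrable _ _)
          (continuous_sqrt_W.intervalIntegrable _ _)).symm
      have h3 : (∫ t in (1 : ℝ)..s, √(W t)) = ∫ t in (1 : ℝ)..s, -(t * (1 - t)) := by
        refine intervalIntegral.integral_congr fun t ht => ?_
        rw [Set.uIcc_of_le h1] at ht
        simp only [sqrt_W]
        rw [abs_of_nonpos (mul_nonpos_of_nonneg_of_nonpos (by linarith [ht.1])
          (by linarith [ht.1]))]
      rw [h2, h3, h01 1 zero_le_one le_rfl, intervalIntegral.integral_neg, hP]; ring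
    rw [this, sqrt_W, hW, abs_of_nonpos (mul_nonpos_of_nonneg_of_nonpos h0 (by linarith))]
    obtain ⟨t, ht, rfl⟩ : ∃ t, 0 ≤ t ∧ s = 1 + t := ⟨s - 1, by linarith, by ring⟩
    rw [abs_le]
    have := pow_nonneg ht 2
    have := pow_nonneg ht 3
    have := pow_nonneg ht 4
    constructor <;> nlinarith

section Approximation

variable {Ω : Opens E3} {V : Type} [NormedAddCommGroup V] [InnerProductSpace ℝ V]

/-! ### Approximation of `H₀¹` by test functions -/

lemma norm_fderiv_le_classicalGrad (f : E3 → V) (x : E3) :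
    ‖fderiv ℝ f x‖ ≤ 3 * ‖classicalGrad f x‖ := by
  refine ContinuousLinearMap.opNorm_le_bound _ (by positivity) fun h => ?_
  have hh : h = ∑ k, h k • EuclideanSpace.single k (1 : ℝ) := by
    ext i
    fin_cases i <;> simp [Fin.sum_univ_three]
  conv_lhs => rw [hh, map_sum]
  calc _ ≤ ∑ k : Fin 3, ‖h‖ * ‖classicalGrad f x‖ := by
        refine (norm_sum_le _ _).trans (Finset.sum_le_sum fun k _ => ?_)
        rw [map_smul, norm_smul]
        gcongr
        · exact PiLp.norm_apply_le h k
        · exact PiLp.norm_apply_le (classicalGrad f x) k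
    _ = _ := by simp; ring

lemma continuous_classicalGrad {f : E3 → V} (hf : ContDiff ℝ 1 f) :
    Continuous (classicalGrad f) := by
  have := hf.continuous_fderiv one_ne_zero
  unfold classicalGrad
  fun_prop

lemma classicalGrad_sub {f g : E3 → V} (hf : ContDiff ℝ 1 f) (hg : ContDiff ℝ 1 g) :
    classicalGrad (f - g) = classicalGrad f - classicalGrad g := by
  funext x
  ext k
  have : fderiv ℝ (f - g) x = fderiv ℝ f x - fderiv ℝ g x :=
    fderiv_sub (hf.differentiable one_ne_zero x) (hg.differentiable one_ne_zero x)
  simp [classicalGrad, this]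

lemma testFunction_contDiff_one (f : 𝓓(Ω, V)) : ContDiff ℝ 1 (f : E3 → V) :=
  f.contDiff.of_le (by exact_mod_cast le_top)

lemma testFunction_support_subset (f : 𝓓(Ω, V)) : Function.support (f : E3 → V) ⊆ Ω :=
  (subset_tsupport _).trans f.tsupport_subset

lemma aestronglyMeasurable_fn (u : H10 Ω V) : AEStronglyMeasurable (fn u) (vol Ω) :=
  Lp.aestronglyMeasurable _

lemma aestronglyMeasurable_wgrad (u : H10 Ω V) : AEStronglyMeasurable (wgrad u) (vol Ω) :=
  Lp.aestronglyMeasurable _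

lemma memLp_fn (u : H10 Ω V) : MemLp (fn u) 2 (vol Ω) := Lp.memLp _

lemma memLp_wgrad (u : H10 Ω V) : MemLp (wgrad u) 2 (vol Ω) := Lp.memLp _

lemma exists_testFunction_seq (u : H10 Ω V) : ∃ f : ℕ → 𝓓(Ω, V),
    Tendsto (fun n => eLpNorm ((f n : E3 → V) - fn u) 2 (vol Ω)) atTop (𝓝 0) ∧
    Tendsto (fun n => eLpNorm (classicalGrad (f n : E3 → V) - wgrad u) 2 (vol Ω)) atTop
      (𝓝 0) := by
  obtain ⟨p, hp, hlim⟩ := mem_closure_iff_seq_limit.1 u.2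
  choose f hf hf' using hp
  have h1 : Tendsto (fun n => (p n).fst) atTop (𝓝 (u : PairSpace Ω V).fst) :=
    ((WithLp.continuous_fst _ _ _).tendsto _).comp hlim
  have h2 : Tendsto (fun n => (p n).snd) atTop (𝓝 (u : PairSpace Ω V).snd) :=
    ((WithLp.continuous_snd _ _ _).tendsto _).comp hlim
  rw [Lp.tendsto_Lp_iff_tendsto_eLpNorm'] at h1 h2
  exact ⟨f, h1.congr fun n => eLpNorm_congr_ae ((hf n).sub .rfl),
    h2.congr fun n => eLpNorm_congr_ae ((hf' n).sub .rfl)⟩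

/-- The Sobolev inequality of `H₀¹(Ω)` into `L⁴(Ω)`, on test functions. -/
lemma exists_eLpNorm_four_le [FiniteDimensional ℝ V] (hΩ : Bornology.IsBounded (Ω : Set E3)) :
    ∃ K : NNReal, ∀ f : E3 → V, ContDiff ℝ 1 f → tsupport f ⊆ Ω →
      eLpNorm f 4 (vol Ω) ≤ K * eLpNorm (classicalGrad f) 2 (vol Ω) := by
  refine ⟨eLpNormLESNormFDerivOfLeConst V (volume : Measure E3) Ω 2 4 * 3, fun f hf hs => ?_⟩
  have h := eLpNorm_le_eLpNorm_fderiv_of_le (p := 2) (q := 4) volume hf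
    ((subset_tsupport f).trans hs) (by norm_num) (by simp; norm_num) (by simp; norm_num) hΩ
  have hD : eLpNorm (fderiv ℝ f) 2 volume ≤ 3 * eLpNorm (classicalGrad f) 2 (vol Ω) := by
    rw [← eLpNorm_restrict_eq_of_support_subset (f := fderiv ℝ f)
      ((support_fderiv_subset ℝ).trans hs)]
    exact eLpNorm_le_nnreal_smul_eLpNorm_of_ae_le_mul (c := 3)
      (Eventually.of_forall fun x => by
        simpa [← NNReal.coe_le_coe] using norm_fderiv_le_classicalGrad f x) 2
  push_cast at h ⊢
  rw [eLpNorm_restrict_eq_of_support_subset ((subset_tsupport f).trans hs), mul_assoc]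
  exact h.trans (by gcongr)

/-- The test functions approximating an element of `H₀¹(Ω)` converge to it in `L⁴(Ω)` as well. -/
lemma exists_testFunction_seq_four [FiniteDimensional ℝ V]
    (hΩ : Bornology.IsBounded (Ω : Set E3)) (u : H10 Ω V) : ∃ f : ℕ → 𝓓(Ω, V),
    Tendsto (fun n => eLpNorm ((f n : E3 → V) - fn u) 2 (vol Ω)) atTop (𝓝 0) ∧
    Tendsto (fun n => eLpNorm ((f n : E3 → V) - fn u) 4 (vol Ω)) atTop (𝓝 0) ∧
    Tendsto (fun n => eLpNorm (classicalGrad (f n : E3 → V) - wgrad u) 2 (vol Ω)) atTop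
      (𝓝 0) := by
  obtain ⟨f, h1, h2⟩ := exists_testFunction_seq u
  obtain ⟨K, hK⟩ := exists_eLpNorm_four_le (V := V) hΩ
  have hmeas : ∀ n, AEStronglyMeasurable (f n : E3 → V) (vol Ω) := fun n =>
    (f n).continuous.aestronglyMeasurable
  have hmeas' : ∀ n, AEStronglyMeasurable (classicalGrad (f n : E3 → V)) (vol Ω) := fun n =>
    (continuous_classicalGrad (testFunction_contDiff_one (f n))).aestronglyMeasurable
  obtain ⟨k, hk, hae⟩ := (tendstoInMeasure_of_tendsto_eLpNorm two_ne_zero hmeas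
    (aestronglyMeasurable_fn u) h1).exists_seq_tendsto_ae
  -- the Sobolev inequality for `f n - f (k m)` and Fatou's lemma as `m → ∞`
  have key : ∀ n, eLpNorm ((f n : E3 → V) - fn u) 4 (vol Ω)
      ≤ K * eLpNorm (classicalGrad (f n : E3 → V) - wgrad u) 2 (vol Ω) := fun n => by
    have hF := Lp.eLpNorm_lim_le_liminf_eLpNorm (p := 4) (μ := vol Ω)
      (f := fun m => (f n : E3 → V) - (f (k m) : E3 → V)) (fun m => (hmeas n).sub (hmeas _))
      ((f n : E3 → V) - fn u) (by
        filter_upwards [hae] with x hx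
        exact tendsto_const_nhds.sub hx)
    refine hF.trans ?_
    have hb : ∀ m, eLpNorm ((f n : E3 → V) - (f (k m) : E3 → V)) 4 (vol Ω)
        ≤ K * (eLpNorm (classicalGrad (f n : E3 → V) - wgrad u) 2 (vol Ω)
          + eLpNorm (classicalGrad (f (k m) : E3 → V) - wgrad u) 2 (vol Ω)) := fun m => by
      have hc := testFunction_contDiff_one (f n)
      have hc' := testFunction_contDiff_one (f (k m))
      refine (hK ((f n : E3 → V) - (f (k m) : E3 → V)) (hc.sub hc') (tsupport_sub _ _ |>.trans
        (Set.union_subset (f n).tsupport_subset (f (k m)).tsupport_subset))).trans ?_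
      gcongr
      rw [classicalGrad_sub hc hc']
      have : classicalGrad (f n : E3 → V) - classicalGrad (f (k m) : E3 → V)
          = (classicalGrad (f n : E3 → V) - wgrad u)
            - (classicalGrad (f (k m) : E3 → V) - wgrad u) := by abel
      rw [this]
      exact eLpNorm_sub_le ((hmeas' _).sub (aestronglyMeasurable_wgrad u))
        ((hmeas' _).sub (aestronglyMeasurable_wgrad u)) one_le_two
    have hlim : Tendsto (fun m => (K : ℝ≥0∞)
        * (eLpNorm (classicalGrad (f n : E3 → V) - wgrad u) 2 (vol Ω)
          + eLpNorm (classicalGrad (f (k m) : E3 → V) - wgrad u) 2 (vol Ω))) atTop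
        (𝓝 (K * (eLpNorm (classicalGrad (f n : E3 → V) - wgrad u) 2 (vol Ω) + 0))) :=
      ENNReal.Tendsto.const_mul (tendsto_const_nhds.add (h2.comp hk.tendsto_atTop))
        (Or.inr ENNReal.coe_ne_top)
    rw [add_zero] at hlim
    rw [← hlim.liminf_eq]
    exact liminf_le_liminf (Eventually.of_forall hb)
  refine ⟨f, h1, tendsto_of_tendsto_of_tendsto_of_le_of_le tendsto_const_nhds ?_
    (fun _ => zero_le) key, h2⟩
  simpa using ENNReal.Tendsto.const_mul h2 (Or.inr (ENNReal.coe_ne_top (r := K)))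

lemma testFunction_memLp (f : 𝓓(Ω, V)) (p : ℝ≥0∞) : MemLp (f : E3 → V) p (vol Ω) :=
  (f.continuous.memLp_of_hasCompactSupport f.hasCompactSupport).restrict _

lemma memLp_four_fn [FiniteDimensional ℝ V] (hΩ : Bornology.IsBounded (Ω : Set E3))
    (u : H10 Ω V) : MemLp (fn u) 4 (vol Ω) := by
  obtain ⟨f, -, h4, -⟩ := exists_testFunction_seq_four hΩ u
  obtain ⟨n, hn⟩ := (h4.eventually (gt_mem_nhds ENNReal.zero_lt_top)).exists
  have : MemLp ((f n : E3 → V) - fn u) 4 (vol Ω) :=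
    ⟨f n |>.continuous.aestronglyMeasurable.sub (aestronglyMeasurable_fn u), hn⟩
  simpa using (testFunction_memLp (f n) 4).sub this

end Approximation

/-! ### Convergence of `Φ` and its gradient along test functions -/

section Composition

variable {Ω : Opens E3}

lemma isFiniteMeasure_vol (hΩ : Bornology.IsBounded (Ω : Set E3)) : IsFiniteMeasure (vol Ω) :=
  ⟨by simpa using hΩ.measure_lt_top⟩

lemma eLpNorm_mul_le {α : Type*} {m : MeasurableSpace α} {μ : Measure α} {f g : α → ℝ}
    {p q r : ℝ≥0∞} [ENNReal.HolderTriple p q r]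
    (hf : AEStronglyMeasurable f μ) (hg : AEStronglyMeasurable g μ) :
    eLpNorm (fun x => f x * g x) r μ ≤ eLpNorm f p μ * eLpNorm g q μ :=
  (eLpNorm_smul_le_mul_eLpNorm (p := p) (q := q) (r := r) hg hf :)

instance : ENNReal.HolderTriple 4 4 2 := ⟨by
  rw [← two_mul, show (4 : ℝ≥0∞) = 2 * 2 by norm_num, ENNReal.mul_inv (by simp) (by simp),
    ← mul_assoc, ENNReal.mul_inv_cancel (by simp) (by simp), one_mul]⟩

/-- The weak gradient of `Φ(φ)`, given by the chain rule. -/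
noncomputable def gradPhi (φ : H10 Ω ℝ) (x : E3) : E3 := √(W (fn φ x)) • wgrad φ x

/-- A common `L⁴` bound for the factor `1 + |fₙ| + |φ|` when `fₙ → φ` in `L⁴`. -/
lemma exists_eLpNorm_one_add_abs_le (hΩ : Bornology.IsBounded (Ω : Set E3)) (φ : H10 Ω ℝ)
    {f : ℕ → 𝓓(Ω, ℝ)}
    (h4 : Tendsto (fun n => eLpNorm ((f n : E3 → ℝ) - fn φ) 4 (vol Ω)) atTop (𝓝 0)) :
    ∃ K : NNReal, ∀ᶠ n in atTop,
      eLpNorm (fun x => 1 + |f n x| + |fn φ x|) 4 (vol Ω) ≤ K := by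
  have := isFiniteMeasure_vol hΩ
  have hφ := memLp_four_fn hΩ φ
  have h1 : MemLp (fun _ : E3 => (1 : ℝ)) 4 (vol Ω) := memLp_const 1
  have hfin : eLpNorm (fun _ : E3 => (1 : ℝ)) 4 (vol Ω) + (1 + eLpNorm (fn φ) 4 (vol Ω))
      + eLpNorm (fn φ) 4 (vol Ω) ≠ ⊤ := by
    simp [h1.2.ne, hφ.2.ne]
  refine ⟨(eLpNorm (fun _ : E3 => (1 : ℝ)) 4 (vol Ω) + (1 + eLpNorm (fn φ) 4 (vol Ω))
    + eLpNorm (fn φ) 4 (vol Ω)).toNNReal, ?_⟩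
  filter_upwards [h4.eventually (gt_mem_nhds zero_lt_one)] with n hn
  rw [ENNReal.coe_toNNReal hfin]
  have hf : eLpNorm (f n : E3 → ℝ) 4 (vol Ω) ≤ 1 + eLpNorm (fn φ) 4 (vol Ω) := by
    have : (f n : E3 → ℝ) = ((f n : E3 → ℝ) - fn φ) + fn φ := by abel
    rw [this]
    refine (eLpNorm_add_le ((f n).continuous.aestronglyMeasurable.sub hφ.1) hφ.1
      (by norm_num)).trans ?_
    gcongr
  have hfm : AEStronglyMeasurable (fun x => |f n x|) (vol Ω) :=
    (f n).continuous.abs.aestronglyMeasurable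
  refine (eLpNorm_add_le (f := fun x => 1 + |f n x|) (g := fun x => |fn φ x|)
    (h1.1.add hfm) hφ.1.norm (by norm_num)).trans ?_
  gcongr
  · refine (eLpNorm_add_le (f := fun _ => (1 : ℝ)) (g := fun x => |f n x|)
      h1.1 hfm (by norm_num)).trans ?_
    gcongr
    exact (eLpNorm_norm (μ := vol Ω) (p := 4) (f n : E3 → ℝ)).le.trans hf
  · exact (eLpNorm_norm (μ := vol Ω) (p := 4) (fn φ)).le

/-- Hölder with exponents `2, 4, 4`: the difference quotient of `Φ` is of quadratic growth. -/
lemma tendsto_eLpNorm_Phi_sub (hΩ : Bornology.IsBounded (Ω : Set E3)) (φ : H10 Ω ℝ)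
    {f : ℕ → 𝓓(Ω, ℝ)}
    (h2 : Tendsto (fun n => eLpNorm ((f n : E3 → ℝ) - fn φ) 2 (vol Ω)) atTop (𝓝 0))
    (h4 : Tendsto (fun n => eLpNorm ((f n : E3 → ℝ) - fn φ) 4 (vol Ω)) atTop (𝓝 0)) :
    Tendsto (fun n => eLpNorm (fun x => Phi (f n x) - Phi (fn φ x)) 1 (vol Ω)) atTop (𝓝 0) := by
  obtain ⟨K, hK⟩ := exists_eLpNorm_one_add_abs_le hΩ φ h4
  have hlim := ENNReal.Tendsto.mul_const h2 (b := (K * K : ℝ≥0∞))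
    (Or.inr (by finiteness))
  rw [zero_mul] at hlim
  refine tendsto_of_tendsto_of_tendsto_of_le_of_le' tendsto_const_nhds hlim
    (Eventually.of_forall fun _ => zero_le) ?_
  filter_upwards [hK] with n hn
  have hm : AEStronglyMeasurable (fun x => 1 + |f n x| + |fn φ x|) (vol Ω) :=
    (aestronglyMeasurable_const.add (f n).continuous.abs.aestronglyMeasurable).add
      (aestronglyMeasurable_fn φ).norm
  have hd : AEStronglyMeasurable ((f n : E3 → ℝ) - fn φ) (vol Ω) :=
    (f n).continuous.aestronglyMeasurable.sub (aestronglyMeasurable_fn φ)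
  calc _ ≤ eLpNorm (fun x => ((f n : E3 → ℝ) - fn φ) x
          * ((1 + |f n x| + |fn φ x|) * (1 + |f n x| + |fn φ x|))) 1 (vol Ω) := by
        refine eLpNorm_mono fun x => ?_
        rw [Real.norm_eq_abs, Real.norm_eq_abs, abs_mul, ← pow_two, abs_pow, sq_abs]
        exact abs_Phi_sub_le _ _
    _ ≤ _ := (eLpNorm_mul_le (p := 2) (q := 2) (r := 1) hd (hm.mul hm))
    _ ≤ _ := by
        gcongr
        refine (eLpNorm_mul_le (p := 4) (q := 4) (r := 2) hm hm).trans ?_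
        gcongr

/-- The increment of `√W` is bounded by that of its argument times a factor of linear growth, hence
small in `L²` by Hölder with exponents `4, 4`; it is then paired with a gradient in `L²`. -/
lemma tendsto_eLpNorm_gradPhi_sub (hΩ : Bornology.IsBounded (Ω : Set E3)) (φ : H10 Ω ℝ)
    {f : ℕ → 𝓓(Ω, ℝ)}
    (h4 : Tendsto (fun n => eLpNorm ((f n : E3 → ℝ) - fn φ) 4 (vol Ω)) atTop (𝓝 0))
    (hg : Tendsto (fun n => eLpNorm (classicalGrad (f n : E3 → ℝ) - wgrad φ) 2 (vol Ω)) atTop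
      (𝓝 0)) :
    Tendsto (fun n => eLpNorm (fun x => √(W (f n x)) • classicalGrad (f n : E3 → ℝ) x
      - gradPhi φ x) 1 (vol Ω)) atTop (𝓝 0) := by
  have := isFiniteMeasure_vol hΩ
  obtain ⟨K, hK⟩ := exists_eLpNorm_one_add_abs_le hΩ φ h4
  have hφ := memLp_four_fn hΩ φ
  have hmW : AEStronglyMeasurable (fun x => √(W (fn φ x))) (vol Ω) :=
    continuous_sqrt_W.comp_aestronglyMeasurable (aestronglyMeasurable_fn φ)
  have hW : MemLp (fun x => √(W (fn φ x))) 2 (vol Ω) := by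
    have hp : MemLp (fun x => fn φ x * (1 - fn φ x)) 2 (vol Ω) :=
      ((memLp_const (1 : ℝ)).sub hφ).mul' (p := 4) (q := 4) hφ
    refine hp.mono hmW (Eventually.of_forall fun x => ?_)
    rw [sqrt_W]
    simp
  have hlim : Tendsto (fun n => (eLpNorm ((f n : E3 → ℝ) - fn φ) 4 (vol Ω) * K)
      * (eLpNorm (classicalGrad (f n : E3 → ℝ) - wgrad φ) 2 (vol Ω)
        + eLpNorm (wgrad φ) 2 (vol Ω))
      + eLpNorm (fun x => √(W (fn φ x))) 2 (vol Ω)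
        * eLpNorm (classicalGrad (f n : E3 → ℝ) - wgrad φ) 2 (vol Ω)) atTop
      (𝓝 ((0 * K) * (0 + eLpNorm (wgrad φ) 2 (vol Ω))
        + eLpNorm (fun x => √(W (fn φ x))) 2 (vol Ω) * 0)) := by
    refine (ENNReal.Tendsto.mul (ENNReal.Tendsto.mul_const h4 (Or.inr (by finiteness)))
      (Or.inr ?_) (hg.add tendsto_const_nhds) (Or.inr ?_)).add
      (ENNReal.Tendsto.const_mul hg (Or.inr hW.2.ne))
    · simpa using (memLp_wgrad φ).2.ne
    · simp
  rw [zero_mul, zero_mul, mul_zero, add_zero] at hlim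
  refine tendsto_of_tendsto_of_tendsto_of_le_of_le' tendsto_const_nhds hlim
    (Eventually.of_forall fun _ => zero_le) ?_
  filter_upwards [hK] with n hn
  have hm : AEStronglyMeasurable (fun x => 1 + |f n x| + |fn φ x|) (vol Ω) :=
    (aestronglyMeasurable_const.add (f n).continuous.abs.aestronglyMeasurable).add
      (aestronglyMeasurable_fn φ).norm
  have hd : AEStronglyMeasurable ((f n : E3 → ℝ) - fn φ) (vol Ω) :=
    (f n).continuous.aestronglyMeasurable.sub (aestronglyMeasurable_fn φ)
  have hmf : AEStronglyMeasurable (fun x => √(W (f n x))) (vol Ω) :=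
    (continuous_sqrt_W.comp (f n).continuous).aestronglyMeasurable
  have hmg : AEStronglyMeasurable (classicalGrad (f n : E3 → ℝ)) (vol Ω) :=
    (continuous_classicalGrad (testFunction_contDiff_one (f n))).aestronglyMeasurable
  have hmw := aestronglyMeasurable_wgrad φ
  have hsplit : (fun x => √(W (f n x)) • classicalGrad (f n : E3 → ℝ) x - gradPhi φ x)
      = ((fun x => √(W (f n x)) - √(W (fn φ x))) • classicalGrad (f n : E3 → ℝ))
        + (fun x => √(W (fn φ x))) • (classicalGrad (f n : E3 → ℝ) - wgrad φ) := by
    funext x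
    simp only [gradPhi, Pi.add_apply, Pi.smul_apply', Pi.sub_apply, sub_smul, smul_sub]
    abel
  rw [hsplit]
  refine (eLpNorm_add_le ((hmf.sub hmW).smul hmg) (hmW.smul (hmg.sub hmw)) le_rfl).trans ?_
  gcongr
  · refine (eLpNorm_smul_le_mul_eLpNorm (p := 2) (q := 2) hmg (hmf.sub hmW)).trans ?_
    gcongr
    · calc _ ≤ eLpNorm (fun x => ((f n : E3 → ℝ) - fn φ) x * (1 + |f n x| + |fn φ x|)) 2
            (vol Ω) := by
            refine eLpNorm_mono fun x => ?_
            rw [Real.norm_eq_abs, Real.norm_eq_abs, abs_mul,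
              abs_of_nonneg (by positivity : 0 ≤ 1 + |f n x| + |fn φ x|)]
            exact abs_sqrt_W_sub_le _ _
        _ ≤ _ := eLpNorm_mul_le (p := 4) (q := 4) (r := 2) hd hm
        _ ≤ _ := by gcongr
    · have : classicalGrad (f n : E3 → ℝ)
          = (classicalGrad (f n : E3 → ℝ) - wgrad φ) + wgrad φ := by abel
      conv_lhs => rw [this]
      exact eLpNorm_add_le (hmg.sub hmw) hmw one_le_two
  · exact eLpNorm_smul_le_mul_eLpNorm (p := 2) (q := 2) (hmg.sub hmw) hmW

end Composition

/-! ### Compactness in `L¹` -/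

section Rellich

lemma lintegral_enorm_translate_sub_le {v : E3 → ℝ} (hv : ContDiff ℝ 1 v) (h : E3) :
    ∫⁻ x, ‖v (x + h) - v x‖ₑ ≤ ‖h‖ₑ * ∫⁻ x, ‖fderiv ℝ v x‖ₑ := by
  have hc : Continuous (fderiv ℝ v) := hv.continuous_fderiv one_ne_zero
  have h1 : ∀ x, ‖v (x + h) - v x‖ₑ
      ≤ ∫⁻ t in Set.Icc (0 : ℝ) 1, ‖fderiv ℝ v (x + t • h)‖ₑ * ‖h‖ₑ := fun x => by
    have hd : ∀ t : ℝ, HasDerivAt (fun t : ℝ => v (x + t • h)) (fderiv ℝ v (x + t • h) h) t :=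
      fun t => by
        have := ((hasDerivAt_id t).smul_const h).const_add x
        simpa using! (hv.differentiable one_ne_zero _).hasFDerivAt.comp_hasDerivAt t this
    have h2 := enorm_sub_le_lintegral_deriv_of_contDiffOn_Icc (a := 0) (b := 1)
      (f := fun t : ℝ => v (x + t • h)) (by fun_prop) zero_le_one
    simp only [one_smul, zero_smul, add_zero] at h2
    refine h2.trans (lintegral_mono fun t => ?_)
    rw [(hd t).deriv]
    exact ContinuousLinearMap.le_opENorm _ _
  have hm : Measurable fun p : E3 × ℝ => ‖fderiv ℝ v (p.1 + p.2 • h)‖ₑ * ‖h‖ₑ := by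
    refine Measurable.mul_const ?_ _
    exact (hc.comp (by fun_prop)).measurable.enorm
  calc _ ≤ ∫⁻ x, ∫⁻ t in Set.Icc (0 : ℝ) 1, ‖fderiv ℝ v (x + t • h)‖ₑ * ‖h‖ₑ :=
        lintegral_mono h1
    _ = ∫⁻ t in Set.Icc (0 : ℝ) 1, ∫⁻ x, ‖fderiv ℝ v (x + t • h)‖ₑ * ‖h‖ₑ :=
        lintegral_lintegral_swap hm.aemeasurable
    _ = ∫⁻ t in Set.Icc (0 : ℝ) 1, ‖h‖ₑ * ∫⁻ x, ‖fderiv ℝ v x‖ₑ := by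
        congr 1 with t
        rw [lintegral_add_right_eq_self (fun x => ‖fderiv ℝ v x‖ₑ * ‖h‖ₑ),
          lintegral_mul_const _ hc.measurable.enorm, mul_comm]
    _ = _ := by simp

/-- The mean oscillation of `v` at `x` at scale `2 δ`, normalised by the volume of a ball of
radius `δ`. -/
noncomputable def osc (v : E3 → ℝ) (δ : ℝ) (x : E3) : ℝ≥0∞ :=
  (volume (Metric.ball (0 : E3) δ))⁻¹ * ∫⁻ h in Metric.ball (0 : E3) (2 * δ), ‖v (x + h) - v x‖ₑ

lemma lintegral_osc_le {v : E3 → ℝ} (hv : ContDiff ℝ 1 v) {δ : ℝ} (hδ : 0 < δ) :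
    ∫⁻ x, osc v δ x ≤ ENNReal.ofReal (16 * δ) * ∫⁻ x, ‖fderiv ℝ v x‖ₑ := by
  have hV : volume (Metric.ball (0 : E3) δ) ≠ 0 := (Metric.measure_ball_pos _ _ hδ).ne'
  have hV' : volume (Metric.ball (0 : E3) δ) ≠ ⊤ := measure_ball_lt_top.ne
  have hm : Measurable fun p : E3 × E3 => ‖v (p.1 + p.2) - v p.1‖ₑ := by
    have := hv.continuous
    exact Continuous.measurable (by fun_prop)
  have hV2 : volume (Metric.ball (0 : E3) (2 * δ))
      = 8 * volume (Metric.ball (0 : E3) δ) := by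
    rw [Measure.addHaar_ball_mul _ _ zero_le_two]
    norm_num
  calc ∫⁻ x, osc v δ x
      = (volume (Metric.ball (0 : E3) δ))⁻¹ * ∫⁻ x, ∫⁻ h in Metric.ball (0 : E3) (2 * δ),
          ‖v (x + h) - v x‖ₑ := lintegral_const_mul' _ _ (ENNReal.inv_ne_top.2 hV)
    _ = (volume (Metric.ball (0 : E3) δ))⁻¹ * ∫⁻ h in Metric.ball (0 : E3) (2 * δ), ∫⁻ x,
          ‖v (x + h) - v x‖ₑ := by rw [lintegral_lintegral_swap hm.aemeasurable]
    _ ≤ (volume (Metric.ball (0 : E3) δ))⁻¹ * ∫⁻ h in Metric.ball (0 : E3) (2 * δ),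
          ENNReal.ofReal (2 * δ) * ∫⁻ x, ‖fderiv ℝ v x‖ₑ := by
        refine mul_le_mul_right (setLIntegral_mono' measurableSet_ball fun h hh => ?_) _
        refine (lintegral_enorm_translate_sub_le hv h).trans (mul_le_mul_left ?_ _)
        rw [← ofReal_norm]
        exact ENNReal.ofReal_le_ofReal (mem_ball_zero_iff.1 hh).le
    _ = ((volume (Metric.ball (0 : E3) δ))⁻¹ * volume (Metric.ball (0 : E3) δ))
          * (8 * ENNReal.ofReal (2 * δ)) * ∫⁻ x, ‖fderiv ℝ v x‖ₑ := by
        rw [setLIntegral_const, hV2]; ring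
    _ = _ := by
        rw [ENNReal.inv_mul_cancel hV hV', one_mul]
        congr 1
        rw [show (8 : ℝ≥0∞) = ENNReal.ofReal 8 by norm_num, ← ENNReal.ofReal_mul (by norm_num)]
        congr 1
        ring

/-- At a point of a ball, a function differs from its mean over the ball by at most its
oscillation. -/
lemma enorm_sub_average_le_osc {v : E3 → ℝ} (hv : Continuous v) {δ : ℝ} (hδ : 0 < δ) {x y : E3}
    (hx : x ∈ Metric.ball y δ) : ‖v x - ⨍ z in Metric.ball y δ, v z‖ₑ ≤ osc v δ x := by
  have hV : volume.real (Metric.ball y δ) ≠ 0 :=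
    (ENNReal.toReal_pos (Metric.measure_ball_pos _ _ hδ).ne' measure_ball_lt_top.ne).ne'
  have hint : IntegrableOn v (Metric.ball y δ) :=
    (hv.continuousOn.integrableOn_compact (isCompact_closedBall y δ)).mono_set
      Metric.ball_subset_closedBall
  have hc : Integrable (fun _ => v x) (volume.restrict (Metric.ball y δ)) :=
    integrableOn_const measure_ball_lt_top.ne (by finiteness)
  have h1 : v x - ⨍ z in Metric.ball y δ, v z
      = (volume.real (Metric.ball y δ))⁻¹ * ∫ z in Metric.ball y δ, (v x - v z) := by
    rw [integral_sub hc hint, setIntegral_const, smul_eq_mul, mul_sub,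
      inv_mul_cancel_left₀ hV, setAverage_eq, smul_eq_mul]
  rw [h1, enorm_mul, osc]
  gcongr
  · rw [enorm_inv hV, Real.enorm_of_nonneg measureReal_nonneg, ofReal_measureReal
      measure_ball_lt_top.ne, Measure.addHaar_ball_center]
  refine (enorm_integral_le_lintegral_enorm _).trans ?_
  have hsub : Metric.ball y δ ⊆ Metric.ball x (2 * δ) := fun z hz => by
    rw [Metric.mem_ball] at *
    linarith [dist_triangle z y x, dist_comm x y]
  refine (lintegral_mono_set hsub).trans (le_of_eq ?_)
  have hp := (measurePreserving_add_left (volume : Measure E3) x).setLIntegral_comp_preimage_emb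
    (measurableEmbedding_addLeft x) (fun z => ‖v x - v z‖ₑ) (Metric.ball x (2 * δ))
  rw [← hp]
  have hpre : (fun h => x + h) ⁻¹' Metric.ball x (2 * δ) = Metric.ball 0 (2 * δ) := by
    ext h
    simp
  rw [hpre]
  exact lintegral_congr fun h => by rw [← enorm_neg, neg_sub]

/-- The cells of a countable measurable partition of space subordinate to balls of radius `δ`
centred at a dense sequence. -/
def cell (δ : ℝ) (n : ℕ) : Set E3 :=
  Metric.ball (denseSeq E3 n) δ \ ⋃ m < n, Metric.ball (denseSeq E3 m) δ

lemma measurableSet_cell (δ : ℝ) (n : ℕ) : MeasurableSet (cell δ n) :=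
  measurableSet_ball.diff (MeasurableSet.biUnion (Set.to_countable _)
    fun _ _ => measurableSet_ball)

lemma cell_eq_of_mem {δ : ℝ} {x : E3} {m n : ℕ} (hm : x ∈ cell δ m) (hn : x ∈ cell δ n) :
    m = n := by
  rcases lt_trichotomy m n with h | h | h
  · exact absurd (Set.mem_biUnion (show m ∈ {k | k < n} from h) hm.1) hn.2
  · exact h
  · exact absurd (Set.mem_biUnion (show n ∈ {k | k < m} from h) hn.1) hm.2

lemma exists_subset_iUnion_cell {s : Set E3} (hs : Bornology.IsBounded s) {δ : ℝ} (hδ : 0 < δ) :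
    ∃ N, ∀ x ∈ s, ∃ n < N, x ∈ cell δ n := by
  classical
  obtain ⟨t, ht⟩ := hs.isCompact_closure.elim_finite_subcover
    (fun n => Metric.ball (denseSeq E3 n) δ) (fun _ => Metric.isOpen_ball) (fun x _ => by
      obtain ⟨n, hn⟩ := (denseRange_denseSeq E3).exists_dist_lt x hδ
      exact Set.mem_iUnion.2 ⟨n, hn⟩)
  refine ⟨t.sup id + 1, fun x hx => ?_⟩
  obtain ⟨m, hm, hxm⟩ := Set.mem_iUnion₂.1 (ht (subset_closure hx))
  have hex : ∃ n, x ∈ Metric.ball (denseSeq E3 n) δ := ⟨m, hxm⟩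
  refine ⟨Nat.find hex, ?_, Nat.find_spec hex, ?_⟩
  · exact Nat.lt_succ_of_le ((Nat.find_min' hex hxm).trans (Finset.le_sup (f := id) hm))
  · simp only [Set.mem_iUnion, not_exists]
    exact fun k hk => Nat.find_min hex hk

/-- The step function with value `c n` on the `n`-th cell, cut off outside `s`. -/
noncomputable def stepFun (s : Set E3) (hs : MeasurableSet s) (hs' : Bornology.IsBounded s)
    (δ : ℝ) (N : ℕ) (c : Fin N → ℝ) : Lp ℝ 1 (volume : Measure E3) :=
  ∑ i, c i • indicatorConstLp 1 (hs.inter (measurableSet_cell δ i))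
    ((measure_mono Set.inter_subset_left).trans_lt hs'.measure_lt_top).ne (1 : ℝ)

lemma stepFun_ae_eq {s : Set E3} (hs : MeasurableSet s) (hs' : Bornology.IsBounded s)
    (δ : ℝ) (N : ℕ) (c : Fin N → ℝ) :
    ∀ᵐ x, (∀ i : Fin N, x ∈ s → x ∈ cell δ i → stepFun s hs hs' δ N c x = c i)
      ∧ (x ∉ s → stepFun s hs hs' δ N c x = 0) := by
  have h1 : ∀ᵐ x, stepFun s hs hs' δ N c x = ∑ i, (c i • indicatorConstLp 1
      (hs.inter (measurableSet_cell δ i))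
      ((measure_mono Set.inter_subset_left).trans_lt hs'.measure_lt_top).ne (1 : ℝ) :
        Lp ℝ 1 (volume : Measure E3)) x :=
    (Lp.coeFn_finsetSum _ _).mono fun x hx => by
      rw [stepFun, hx, Finset.sum_apply]
  have h2 : ∀ᵐ x, ∀ i : Fin N, (c i • indicatorConstLp 1 (hs.inter (measurableSet_cell δ i))
      ((measure_mono Set.inter_subset_left).trans_lt hs'.measure_lt_top).ne (1 : ℝ) :
        Lp ℝ 1 (volume : Measure E3)) x = c i * (s ∩ cell δ i).indicator (fun _ => 1) x := by
    rw [ae_all_iff]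
    intro i
    filter_upwards [Lp.coeFn_smul (c i) (indicatorConstLp 1 (hs.inter (measurableSet_cell δ i))
      ((measure_mono Set.inter_subset_left).trans_lt hs'.measure_lt_top).ne (1 : ℝ) :
        Lp ℝ 1 (volume : Measure E3)), indicatorConstLp_coeFn (p := 1)
        (hs := hs.inter (measurableSet_cell δ i))
        (hμs := ((measure_mono Set.inter_subset_left).trans_lt hs'.measure_lt_top).ne)
        (c := (1 : ℝ)) (μ := (volume : Measure E3))] with x hx hx'
    rw [hx, Pi.smul_apply, hx', smul_eq_mul]
  filter_upwards [h1, h2] with x hx hx'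
  rw [hx]
  simp only [hx']
  refine ⟨fun i hxs hxi => ?_, fun hxs => ?_⟩
  · rw [Finset.sum_eq_single i (fun j _ hj => ?_) (by simp)]
    · rw [Set.indicator_of_mem (Set.mem_inter hxs hxi), mul_one]
    · rw [Set.indicator_of_notMem, mul_zero]
      exact fun h => hj (Fin.ext (cell_eq_of_mem (Set.mem_of_mem_inter_right h) hxi))
  · exact Finset.sum_eq_zero fun j _ => by
      rw [Set.indicator_of_notMem (fun h => hxs h.1), mul_zero]

/-- Functions supported in a fixed bounded set and bounded in `W^{1,1}` are uniformly close in
`L¹` to a compact set of step functions: on each cell, the function is replaced by its mean over the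
ball that contains the cell. -/
lemma exists_isCompact_approx {s : Set E3} (hs : MeasurableSet s) (hs' : Bornology.IsBounded s)
    (K : NNReal) {δ : ℝ} (hδ : 0 < δ) :
    ∃ T : Set (Lp ℝ 1 (volume : Measure E3)), IsCompact T ∧ ∀ v : E3 → ℝ, ContDiff ℝ 1 v →
      Function.support v ⊆ s → ∫⁻ x, ‖v x‖ₑ ≤ K → ∫⁻ x, ‖fderiv ℝ v x‖ₑ ≤ K →
      ∃ g ∈ T, eLpNorm (v - (g : E3 → ℝ)) 1 volume ≤ ENNReal.ofReal (16 * δ) * K := by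
  obtain ⟨N, hN⟩ := exists_subset_iUnion_cell hs' hδ
  set R : ℝ := (volume.real (Metric.ball (0 : E3) δ))⁻¹ * K
  refine ⟨stepFun s hs hs' δ N '' Set.pi Set.univ fun _ => Metric.closedBall 0 R,
    (isCompact_univ_pi fun _ => isCompact_closedBall _ _).image (by unfold stepFun; fun_prop),
    fun v hv hvs hvK hDK => ?_⟩
  refine ⟨_, ⟨fun i => ⨍ z in Metric.ball (denseSeq E3 i) δ, v z, fun i _ => ?_, rfl⟩, ?_⟩
  · simp only [mem_closedBall_zero_iff]
    rw [setAverage_eq, norm_smul, norm_inv,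
      Real.norm_of_nonneg measureReal_nonneg, measureReal_def, Measure.addHaar_ball_center,
      ← measureReal_def]
    refine mul_le_mul_of_nonneg_left ?_ (by positivity)
    rw [← toReal_enorm]
    refine ENNReal.toReal_le_coe_of_le_coe
      ((enorm_integral_le_lintegral_enorm _).trans ((setLIntegral_le_lintegral _ _).trans hvK))
  · rw [eLpNorm_one_eq_lintegral_enorm]
    refine le_trans (lintegral_mono_ae ?_)
      ((lintegral_osc_le hv hδ).trans (mul_le_mul_right hDK _))
    filter_upwards [stepFun_ae_eq hs hs' δ N
      (fun i => ⨍ z in Metric.ball (denseSeq E3 i) δ, v z)] with x hx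
    rw [Pi.sub_apply]
    by_cases hxs : x ∈ s
    · obtain ⟨n, hn, hxn⟩ := hN x hxs
      rw [hx.1 ⟨n, hn⟩ hxs hxn]
      exact enorm_sub_average_le_osc hv.continuous hδ hxn.1
    · rw [hx.2 hxs, Function.notMem_support.1 (fun h => hxs (hvs h))]
      simp

/-- **Rellich's theorem** in `W^{1,1}`: a sequence of `C¹` functions supported in a fixed bounded
set, with bounded gradients in `L¹`, has a subsequence that converges in `L¹`. -/
theorem exists_subseq_tendsto_of_lintegral_fderiv_le {s : Set E3} (hs : MeasurableSet s)
    (hs' : Bornology.IsBounded s) {K : NNReal} {v : ℕ → E3 → ℝ} (hv : ∀ n, ContDiff ℝ 1 (v n))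
    (hvs : ∀ n, Function.support (v n) ⊆ s) (hD : ∀ n, ∫⁻ x, ‖fderiv ℝ (v n) x‖ₑ ≤ K) :
    ∃ k : ℕ → ℕ, StrictMono k ∧ ∃ w : E3 → ℝ, MemLp w 1 volume ∧
      Tendsto (fun n => eLpNorm (v (k n) - w) 1 volume) atTop (𝓝 0) := by
  have hL : ∃ K' : NNReal, ∀ n, ∫⁻ x, ‖v n x‖ₑ ≤ K' := by
    refine ⟨eLpNormLESNormFDerivOfLeConst ℝ (volume : Measure E3) s 1 1 * K, fun n => ?_⟩
    have h := eLpNorm_le_eLpNorm_fderiv (p := 1) volume (hv n) (hvs n) le_rfl (by simp) hs'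
    simp only [ENNReal.coe_one, eLpNorm_one_eq_lintegral_enorm] at h
    push_cast
    exact h.trans (mul_le_mul_right (hD n) _)
  obtain ⟨K', hK'⟩ := hL
  have hmem : ∀ n, MemLp (v n) 1 volume := fun n =>
    ⟨(hv n).continuous.aestronglyMeasurable, by
      rw [eLpNorm_one_eq_lintegral_enorm]
      exact (hK' n).trans_lt ENNReal.coe_lt_top⟩
  set V : ℕ → Lp ℝ 1 (volume : Measure E3) := fun n => (hmem n).toLp (v n)
  have htb : TotallyBounded (Set.range V) := by
    rw [Metric.totallyBounded_iff]
    intro η hη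
    set L : NNReal := max K K'
    obtain ⟨δ, hδ, hδη⟩ : ∃ δ : ℝ, 0 < δ ∧ 16 * δ * L < η / 2 := by
      refine ⟨η / (64 * (L + 1)), by positivity, ?_⟩
      have : (L : ℝ) / (L + 1) ≤ 1 := (div_le_one (by positivity)).2 (by linarith)
      calc 16 * (η / (64 * (L + 1))) * L = η / 4 * (L / (L + 1)) := by field_simp; ring
        _ ≤ η / 4 * 1 := by gcongr
        _ < η / 2 := by linarith
    obtain ⟨T, hT, hTv⟩ := exists_isCompact_approx hs hs' L hδ
    obtain ⟨t, htfin, ht⟩ := Metric.totallyBounded_iff.1 hT.totallyBounded (η / 2) (by positivity)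
    refine ⟨t, htfin, ?_⟩
    rintro _ ⟨n, rfl⟩
    obtain ⟨g, hg, hgv⟩ := hTv (v n) (hv n) (hvs n)
      ((hK' n).trans (by simp [L])) ((hD n).trans (by simp [L]))
    obtain ⟨y, hy, hgy⟩ := Set.mem_iUnion₂.1 (ht hg)
    refine Set.mem_iUnion₂.2 ⟨y, hy, ?_⟩
    rw [Metric.mem_ball] at hgy ⊢
    have : dist (V n) g < η / 2 := by
      rw [Lp.dist_def, eLpNorm_congr_ae ((hmem n).coeFn_toLp.sub .rfl)]
      refine lt_of_le_of_lt (ENNReal.toReal_mono (by finiteness) hgv) ?_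
      rw [ENNReal.toReal_mul, ENNReal.toReal_ofReal (by positivity)]
      simpa using hδη
    linarith [dist_triangle (V n) g y]
  obtain ⟨w, -, k, hk, hlim⟩ := htb.closure.isCompact_of_isClosed isClosed_closure
    |>.tendsto_subseq (fun n => subset_closure (Set.mem_range_self n) : ∀ n, V n ∈ _)
  refine ⟨k, hk, w, Lp.memLp w, ?_⟩
  rw [Lp.tendsto_Lp_iff_tendsto_eLpNorm'] at hlim
  exact hlim.congr fun n => eLpNorm_congr_ae ((hmem (k n)).coeFn_toLp.sub .rfl)

end Rellich

/-! ### The gradient of `Φ(φ)` -/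

section PhaseField

variable {Ω : Opens E3}

lemma aestronglyMeasurable_gradPhi (φ : H10 Ω ℝ) :
    AEStronglyMeasurable (gradPhi φ) (vol Ω) :=
  (continuous_sqrt_W.comp_aestronglyMeasurable (aestronglyMeasurable_fn φ)).smul
    (aestronglyMeasurable_wgrad φ)

lemma testFunction_phi_contDiff (f : 𝓓(Ω, ℝ)) : ContDiff ℝ 1 fun x => Phi (f x) :=
  contDiff_Phi.comp (testFunction_contDiff_one f)

lemma hasFDerivAt_Phi_comp (f : 𝓓(Ω, ℝ)) (x : E3) :
    HasFDerivAt (fun x => Phi (f x)) (√(W (f x)) • fderiv ℝ (f : E3 → ℝ) x) x :=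
  (hasDerivAt_Phi (f x)).comp_hasFDerivAt x
    ((testFunction_contDiff_one f).differentiable one_ne_zero x).hasFDerivAt

lemma support_Phi_comp_subset (f : 𝓓(Ω, ℝ)) :
    (Function.support fun x => Phi (f x)) ⊆ Function.support (f : E3 → ℝ) := fun x hx h => by
  simp [h, Phi_zero] at hx

lemma hasCompactSupport_Phi_comp (f : 𝓓(Ω, ℝ)) : HasCompactSupport fun x => Phi (f x) :=
  f.hasCompactSupport.mono (support_Phi_comp_subset f)

lemma continuous_smul_classicalGrad (f : 𝓓(Ω, ℝ)) :
    Continuous fun x => √(W (f x)) • classicalGrad (f : E3 → ℝ) x :=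
  (continuous_sqrt_W.comp f.continuous).smul
    (continuous_classicalGrad (testFunction_contDiff_one f))

lemma hasCompactSupport_classicalGrad (f : 𝓓(Ω, ℝ)) :
    HasCompactSupport (classicalGrad (f : E3 → ℝ)) := by
  refine f.hasCompactSupport.fderiv (𝕜 := ℝ) |>.mono fun x hx h => hx ?_
  ext k
  simp [classicalGrad, h]

lemma integrable_Phi_comp (f : 𝓓(Ω, ℝ)) : Integrable (fun x => Phi (f x)) (vol Ω) :=
  ((testFunction_phi_contDiff f).continuous.integrable_of_hasCompactSupport
    (hasCompactSupport_Phi_comp f)).restrict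

lemma integrable_smul_classicalGrad (f : 𝓓(Ω, ℝ)) :
    Integrable (fun x => √(W (f x)) • classicalGrad (f : E3 → ℝ) x) (vol Ω) :=
  ((continuous_smul_classicalGrad f).integrable_of_hasCompactSupport
    ((hasCompactSupport_classicalGrad f).mono fun x hx h => hx (by simp [h]))).restrict

lemma integrable_gradPhi (hΩ : Bornology.IsBounded (Ω : Set E3)) (φ : H10 Ω ℝ) :
    Integrable (gradPhi φ) (vol Ω) := by
  obtain ⟨f, -, h4, hg⟩ := exists_testFunction_seq_four hΩ φ
  obtain ⟨n, hn⟩ := ((tendsto_eLpNorm_gradPhi_sub hΩ φ h4 hg).eventually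
    (gt_mem_nhds ENNReal.zero_lt_top)).exists
  have h := integrable_smul_classicalGrad (f n)
  have hd : Integrable (fun x => √(W (f n x)) • classicalGrad (f n : E3 → ℝ) x - gradPhi φ x)
      (vol Ω) := memLp_one_iff_integrable.1 ⟨h.1.sub (aestronglyMeasurable_gradPhi φ), hn⟩
  refine (h.sub hd).congr (Eventually.of_forall fun x => ?_)
  simp

lemma integrable_Phi_fn (hΩ : Bornology.IsBounded (Ω : Set E3)) (φ : H10 Ω ℝ) :
    Integrable (fun x => Phi (fn φ x)) (vol Ω) := by
  obtain ⟨f, h2, h4, -⟩ := exists_testFunction_seq_four hΩ φ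
  obtain ⟨n, hn⟩ := ((tendsto_eLpNorm_Phi_sub hΩ φ h2 h4).eventually
    (gt_mem_nhds ENNReal.zero_lt_top)).exists
  have h := integrable_Phi_comp (f n)
  have hd : Integrable (fun x => Phi (f n x) - Phi (fn φ x)) (vol Ω) :=
    memLp_one_iff_integrable.1
      ⟨h.1.sub (continuous_Phi.comp_aestronglyMeasurable (aestronglyMeasurable_fn φ)), hn⟩
  refine (h.sub hd).congr (Eventually.of_forall fun x => ?_)
  simp

lemma tendsto_integral_mul_of_tendsto_eLpNorm {α : Type*} {m : MeasurableSpace α}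
    {μ : Measure α} {a : ℕ → α → ℝ} {a' b : α → ℝ} {C : NNReal}
    (ha : ∀ n, Integrable (a n) μ) (ha' : Integrable a' μ) (hb : AEStronglyMeasurable b μ)
    (hC : ∀ x, ‖b x‖₊ ≤ C)
    (h : Tendsto (fun n => eLpNorm (fun x => a n x - a' x) 1 μ) atTop (𝓝 0)) :
    Tendsto (fun n => ∫ x, a n x * b x ∂μ) atTop (𝓝 (∫ x, a' x * b x ∂μ)) := by
  refine tendsto_integral_of_L1' _ ?_ ?_ ?_
  · exact ha'.1.mul hb
  · exact Eventually.of_forall fun n => (ha n).mul_bdd hb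
      (Eventually.of_forall fun x => show ‖b x‖ ≤ (C : ℝ) by exact_mod_cast hC x)
  · have hlim := ENNReal.Tendsto.const_mul h (Or.inr (ENNReal.coe_ne_top (r := C)))
    rw [mul_zero] at hlim
    refine tendsto_of_tendsto_of_tendsto_of_le_of_le tendsto_const_nhds hlim
      (fun _ => zero_le) fun n => ?_
    refine eLpNorm_le_nnreal_smul_eLpNorm_of_ae_le_mul (Eventually.of_forall fun x => ?_) 1
    rw [Pi.sub_apply, ← sub_mul, nnnorm_mul, mul_comm]
    gcongr
    exact hC x

lemma integral_Phi_comp_mul_grad (f ψ : 𝓓(Ω, ℝ)) (k : Fin 3) :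
    ∫ x in (Ω : Set E3), Phi (f x) * classicalGrad (ψ : E3 → ℝ) x k
      = -∫ x in (Ω : Set E3), (√(W (f x)) • classicalGrad (f : E3 → ℝ) x) k * ψ x := by
  have hf := testFunction_phi_contDiff f
  have hψ := testFunction_contDiff_one ψ
  have hcg : Continuous fun x => fderiv ℝ (ψ : E3 → ℝ) x (EuclideanSpace.single k 1) :=
    (hψ.continuous_fderiv one_ne_zero).clm_apply continuous_const
  have hcf : Continuous fun x => fderiv ℝ (fun x => Phi (f x)) x (EuclideanSpace.single k 1) :=
    (hf.continuous_fderiv one_ne_zero).clm_apply continuous_const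
  have h := integral_mul_fderiv_eq_neg_fderiv_mul_of_integrable (μ := (volume : Measure E3))
    (f := fun x => Phi (f x)) (g := (ψ : E3 → ℝ)) (v := EuclideanSpace.single k 1)
    ((hcf.mul ψ.continuous).integrable_of_hasCompactSupport ψ.hasCompactSupport.mul_left)
    ((hf.continuous.mul hcg).integrable_of_hasCompactSupport
      (hasCompactSupport_Phi_comp f).mul_right)
    ((hf.continuous.mul ψ.continuous).integrable_of_hasCompactSupport
      ψ.hasCompactSupport.mul_left)
    (fun x _ => hf.differentiable one_ne_zero x) (fun x _ => hψ.differentiable one_ne_zero x)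
  rw [setIntegral_eq_integral_of_forall_compl_eq_zero,
    setIntegral_eq_integral_of_forall_compl_eq_zero]
  · refine h.trans ?_
    congr 1
    refine integral_congr_ae (Eventually.of_forall fun x => ?_)
    simp only [(hasFDerivAt_Phi_comp f x).fderiv]
    simp [classicalGrad]
  · intro x hx
    rw [Function.notMem_support.1 fun h => hx (testFunction_support_subset ψ h), mul_zero]
  · intro x hx
    rw [Function.notMem_support.1 fun h => hx (testFunction_support_subset f
      (support_Phi_comp_subset f h)), zero_mul]

/-- The chain rule: `Φ(φ)` has the weak gradient `√W(φ) ∇φ`. -/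
lemma hasWeakGradient_gradPhi (hΩ : Bornology.IsBounded (Ω : Set E3)) (φ : H10 Ω ℝ) :
    HasWeakGradient Ω (fun x => Phi (fn φ x)) (gradPhi φ) := by
  have hP := integrable_Phi_fn hΩ φ
  have hG := integrable_gradPhi hΩ φ
  refine ⟨IntegrableOn.locallyIntegrableOn hP, IntegrableOn.locallyIntegrableOn hG,
    fun ψ k => ?_⟩
  obtain ⟨f, h2, h4, hg⟩ := exists_testFunction_seq_four hΩ φ
  have hψ := continuous_classicalGrad (testFunction_contDiff_one ψ)
  have hψk : Continuous fun x => classicalGrad (ψ : E3 → ℝ) x k :=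
    (PiLp.continuous_apply 2 _ k).comp hψ
  obtain ⟨C, hC⟩ := ψ.hasCompactSupport.exists_bound_of_continuous ψ.continuous
  obtain ⟨C', hC'⟩ := (hasCompactSupport_classicalGrad ψ).exists_bound_of_continuous hψ
  have hL := tendsto_integral_mul_of_tendsto_eLpNorm (C := C'.toNNReal)
    (fun n => integrable_Phi_comp (f n)) hP hψk.aestronglyMeasurable
    (fun x => by
      rw [← NNReal.coe_le_coe, coe_nnnorm]
      exact ((PiLp.norm_apply_le (classicalGrad (ψ : E3 → ℝ) x) k).trans (hC' x)).trans
        (Real.le_coe_toNNReal C')) (tendsto_eLpNorm_Phi_sub hΩ φ h2 h4)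
  have hR := tendsto_integral_mul_of_tendsto_eLpNorm (C := C.toNNReal)
    (a := fun n x => (√(W (f n x)) • classicalGrad (f n : E3 → ℝ) x) k)
    (a' := fun x => gradPhi φ x k) (b := (ψ : E3 → ℝ))
    (fun n => (integrable_smul_classicalGrad (f n)).eval_piLp k)
    (hG.eval_piLp k)
    ψ.continuous.aestronglyMeasurable
    (fun x => by
      rw [← NNReal.coe_le_coe, coe_nnnorm]
      exact (hC x).trans (Real.le_coe_toNNReal C)) (by
      refine tendsto_of_tendsto_of_tendsto_of_le_of_le tendsto_const_nhds
        (tendsto_eLpNorm_gradPhi_sub hΩ φ h4 hg) (fun _ => zero_le) fun n => ?_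
      exact eLpNorm_mono fun x => PiLp.norm_apply_le
        (√(W (f n x)) • classicalGrad (f n : E3 → ℝ) x - gradPhi φ x) k)
  exact tendsto_nhds_unique hL
    (hR.neg.congr fun n => (integral_Phi_comp_mul_grad (f n) ψ k).symm)

/-! ### Bounds from the mixing energy -/

lemma lintegral_gradPhi_le_energyMix {ε : ℝ} (hε : 0 < ε) (φ : H10 Ω ℝ) :
    ∫⁻ x, ‖gradPhi φ x‖ₑ ∂(vol Ω) ≤ energyMix ε φ := by
  refine lintegral_mono fun x => ?_
  rw [← ofReal_norm]
  refine ENNReal.ofReal_le_ofReal ?_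
  rw [gradPhi, norm_smul, Real.norm_of_nonneg (Real.sqrt_nonneg _)]
  have h := Real.sq_sqrt (W_nonneg (fn φ x))
  set w := √(W (fn φ x))
  set g := ‖wgrad φ x‖
  rw [← h]
  have h2 : ε * g ^ 2 + ε⁻¹ * w ^ 2 - w * g = ε⁻¹ * ((ε * g - w / 2) ^ 2 + 3 / 4 * w ^ 2) := by
    field_simp
    ring
  have : 0 ≤ ε⁻¹ * ((ε * g - w / 2) ^ 2 + 3 / 4 * w ^ 2) := by positivity
  linarith

lemma lintegral_W_le {ε : ℝ} (hε : 0 < ε) (φ : H10 Ω ℝ) :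
    ∫⁻ x, ENNReal.ofReal (W (fn φ x)) ∂(vol Ω) ≤ ENNReal.ofReal ε * energyMix ε φ := by
  rw [energyMix, ← lintegral_const_mul' _ _ ENNReal.ofReal_ne_top]
  refine lintegral_mono fun x => ?_
  rw [← ENNReal.ofReal_mul hε.le]
  refine ENNReal.ofReal_le_ofReal ?_
  have h : ε * (ε * ‖wgrad φ x‖ ^ 2 + ε⁻¹ * W (fn φ x))
      = ε ^ 2 * ‖wgrad φ x‖ ^ 2 + W (fn φ x) := by field_simp
  rw [h]
  have : 0 ≤ ε ^ 2 * ‖wgrad φ x‖ ^ 2 := by positivity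
  linarith

/-- A sequence with bounded mixing energies is asymptotic in `L¹` to `6 Φ(φₙ)`. -/
lemma tendsto_eLpNorm_sub_six_mul_Phi (hΩ : Bornology.IsBounded (Ω : Set E3)) {ε : ℕ → ℝ}
    (hε : ∀ n, 0 < ε n) (hε0 : Tendsto ε atTop (𝓝 0)) {φ : ℕ → H10 Ω ℝ} {M : ℝ}
    (hM : ∀ n, energyMix (ε n) (φ n) ≤ ENNReal.ofReal M) :
    Tendsto (fun n => eLpNorm (fun x => fn (φ n) x - 6 * Phi (fn (φ n) x)) 1 (vol Ω)) atTop
      (𝓝 0) := by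
  have := isFiniteMeasure_vol hΩ
  have hs : Tendsto (fun n => √(ε n)) atTop (𝓝 0) := by
    simpa using! (Real.continuous_sqrt.tendsto 0).comp hε0
  have hlim : Tendsto (fun n => ENNReal.ofReal (3 * √(ε n)) * vol Ω Set.univ
      + ENNReal.ofReal (3 * (√(ε n) + ε n)) * ENNReal.ofReal M) atTop (𝓝 0) := by
    have h1 := ENNReal.Tendsto.mul_const (ENNReal.tendsto_ofReal (hs.const_mul 3))
      (Or.inr (measure_ne_top (vol Ω) Set.univ))
    have h2 := ENNReal.Tendsto.mul_const (ENNReal.tendsto_ofReal ((hs.add hε0).const_mul 3))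
      (Or.inr (ENNReal.ofReal_ne_top (r := M)))
    simpa using! h1.add h2
  refine tendsto_of_tendsto_of_tendsto_of_le_of_le tendsto_const_nhds hlim
    (fun _ => zero_le) fun n => ?_
  have hr : 0 < √(ε n) := Real.sqrt_pos.2 (hε n)
  -- Young's inequality `√W ≤ √ε + W / √ε` replaces `√W` by quantities of order `√ε`
  have hpt : ∀ x, ‖fn (φ n) x - 6 * Phi (fn (φ n) x)‖ₑ ≤ ENNReal.ofReal (3 * √(ε n))
      + ENNReal.ofReal (3 * ((√(ε n))⁻¹ + 1)) * ENNReal.ofReal (W (fn (φ n) x)) := fun x => by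
    rw [← ofReal_norm, ← ENNReal.ofReal_mul (by positivity),
      ← ENNReal.ofReal_add (by positivity) (mul_nonneg (by positivity) (W_nonneg _))]
    refine ENNReal.ofReal_le_ofReal ((abs_sub_six_mul_Phi_le _).trans ?_)
    have h := Real.sq_sqrt (W_nonneg (fn (φ n) x))
    set w := √(W (fn (φ n) x))
    set r := √(ε n)
    rw [← h]
    have h2 : r + r⁻¹ * w ^ 2 - w = r⁻¹ * ((r - w / 2) ^ 2 + 3 / 4 * w ^ 2) := by
      field_simp
      ring
    have : 0 ≤ r⁻¹ * ((r - w / 2) ^ 2 + 3 / 4 * w ^ 2) := by positivity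
    linarith
  rw [eLpNorm_one_eq_lintegral_enorm]
  refine (lintegral_mono hpt).trans ?_
  rw [lintegral_add_left measurable_const, lintegral_const,
    lintegral_const_mul' _ _ ENNReal.ofReal_ne_top]
  refine add_le_add le_rfl ?_
  calc _ ≤ ENNReal.ofReal (3 * ((√(ε n))⁻¹ + 1)) * (ENNReal.ofReal (ε n) * ENNReal.ofReal M) := by
        gcongr
        exact (lintegral_W_le (hε n) (φ n)).trans (mul_le_mul_right (hM n) _)
    _ = _ := by
        rw [← mul_assoc, ← ENNReal.ofReal_mul (by positivity)]
        congr 2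
        have : (√(ε n))⁻¹ * ε n = √(ε n) := by rw [inv_mul_eq_div, Real.div_sqrt]
        linear_combination 3 * this

lemma lintegral_fderiv_Phi_comp_le (f : 𝓓(Ω, ℝ)) :
    ∫⁻ x, ‖fderiv ℝ (fun x => Phi (f x)) x‖ₑ
      ≤ 3 * eLpNorm (fun x => √(W (f x)) • classicalGrad (f : E3 → ℝ) x) 1 (vol Ω) := by
  have hs : Function.support (fderiv ℝ fun x => Phi (f x)) ⊆ (Ω : Set E3) :=
    (support_fderiv_subset ℝ).trans
      ((closure_mono (support_Phi_comp_subset f)).trans f.tsupport_subset)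
  rw [← eLpNorm_one_eq_lintegral_enorm,
    ← eLpNorm_restrict_eq_of_support_subset (f := fderiv ℝ fun x => Phi (f x)) hs]
  refine eLpNorm_le_nnreal_smul_eLpNorm_of_ae_le_mul (c := 3) (Eventually.of_forall fun x => ?_) 1
  rw [(hasFDerivAt_Phi_comp f x).fderiv, nnnorm_smul, nnnorm_smul, mul_left_comm]
  gcongr
  simpa [← NNReal.coe_le_coe] using norm_fderiv_le_classicalGrad (f : E3 → ℝ) x

/-- A phase field is approximated by a test function, in the `W^{1,1}` distance of `Φ`. -/
lemma exists_testFunction_Phi_close (hΩ : Bornology.IsBounded (Ω : Set E3)) (φ : H10 Ω ℝ)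
    {η : ℝ≥0∞} (hη : 0 < η) : ∃ f : 𝓓(Ω, ℝ),
      eLpNorm (fun x => Phi (f x) - Phi (fn φ x)) 1 (vol Ω) < η ∧
      ∫⁻ x, ‖fderiv ℝ (fun x => Phi (f x)) x‖ₑ ≤ 3 * (∫⁻ x, ‖gradPhi φ x‖ₑ ∂(vol Ω) + 1) := by
  obtain ⟨f, h2, h4, hg⟩ := exists_testFunction_seq_four hΩ φ
  obtain ⟨n, hn, hn'⟩ := (((tendsto_eLpNorm_Phi_sub hΩ φ h2 h4).eventually
    (gt_mem_nhds hη)).and ((tendsto_eLpNorm_gradPhi_sub hΩ φ h4 hg).eventually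
    (gt_mem_nhds zero_lt_one))).exists
  refine ⟨f n, hn, (lintegral_fderiv_Phi_comp_le (f n)).trans (mul_le_mul_right ?_ _)⟩
  have : (fun x => √(W (f n x)) • classicalGrad (f n : E3 → ℝ) x)
      = gradPhi φ + fun x => √(W (f n x)) • classicalGrad (f n : E3 → ℝ) x - gradPhi φ x := by
    funext x
    simp
  rw [this]
  refine (eLpNorm_add_le (aestronglyMeasurable_gradPhi φ)
    ((integrable_smul_classicalGrad (f n)).1.sub (aestronglyMeasurable_gradPhi φ)) le_rfl).trans ?_
  rw [eLpNorm_one_eq_lintegral_enorm (f := gradPhi φ)]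
  exact add_le_add le_rfl hn'.le

/-! ### Compactness of the phase fields -/

theorem precompactL1_of_energyMix_le (hΩ : Bornology.IsBounded (Ω : Set E3)) {ε : ℕ → ℝ}
    (hε : ∀ n, 0 < ε n) (hε0 : Tendsto ε atTop (𝓝 0)) {φ : ℕ → H10 Ω ℝ} {M : ℝ}
    (hM : ∀ n, energyMix (ε n) (φ n) ≤ ENNReal.ofReal M) :
    PrecompactL1 Ω fun n => fn (φ n) := by
  intro j hj
  have hη : ∀ n : ℕ, (0 : ℝ≥0∞) < ENNReal.ofReal (1 / ((n : ℝ) + 1)) := fun n =>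
    ENNReal.ofReal_pos.2 (by positivity)
  choose f hf hf' using fun n => exists_testFunction_Phi_close hΩ (φ (j n)) (hη n)
  obtain ⟨k, hk, w, hw, hlim⟩ := exists_subseq_tendsto_of_lintegral_fderiv_le
    Ω.isOpen.measurableSet hΩ (K := 3 * (M.toNNReal + 1)) (v := fun n x => Phi (f n x))
    (fun n => testFunction_phi_contDiff (f n))
    (fun n => (support_Phi_comp_subset (f n)).trans (testFunction_support_subset (f n)))
    (fun n => (hf' n).trans (by
      push_cast
      gcongr
      exact (lintegral_gradPhi_le_energyMix (hε _) _).trans (hM _)))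
  refine ⟨k, hk, fun x => 6 * w x, (hw.restrict _).const_mul 6, ?_⟩
  have h1 := (tendsto_eLpNorm_sub_six_mul_Phi hΩ hε hε0 hM).comp (hj.comp hk).tendsto_atTop
  have h2 : Tendsto (fun n => eLpNorm (fun x => Phi (f (k n) x) - Phi (fn (φ (j (k n))) x)) 1
      (vol Ω)) atTop (𝓝 0) := by
    have h0 := ENNReal.tendsto_ofReal (tendsto_one_div_add_atTop_nhds_zero_nat (𝕜 := ℝ))
    rw [ENNReal.ofReal_zero] at h0
    exact tendsto_of_tendsto_of_tendsto_of_le_of_le tendsto_const_nhds (h0.comp hk.tendsto_atTop)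
      (fun _ => zero_le) fun n => (hf (k n)).le
  have hsum := h1.add ((ENNReal.Tendsto.const_mul h2 (Or.inr (ENNReal.coe_ne_top (r := 6)))).add
    (ENNReal.Tendsto.const_mul hlim (Or.inr (ENNReal.coe_ne_top (r := 6)))))
  simp only [mul_zero, add_zero] at hsum
  refine tendsto_of_tendsto_of_tendsto_of_le_of_le tendsto_const_nhds hsum
    (fun _ => zero_le) fun n => ?_
  have hmφ := aestronglyMeasurable_fn (φ (j (k n)))
  have hmP := continuous_Phi.comp_aestronglyMeasurable hmφ
  have hmf := (integrable_Phi_comp (f (k n))).1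
  have hmw : AEStronglyMeasurable w (vol Ω) := hw.1.restrict
  have hsplit : (fun x => fn (φ (j (k n))) x - 6 * w x)
      = (fun x => fn (φ (j (k n))) x - 6 * Phi (fn (φ (j (k n))) x))
        + ((-6 : ℝ) • (fun x => Phi (f (k n) x) - Phi (fn (φ (j (k n))) x))
          + (6 : ℝ) • ((fun x => Phi (f (k n) x)) - w)) := by
    funext x
    simp only [Pi.add_apply, Pi.smul_apply, Pi.sub_apply, smul_eq_mul]
    ring
  rw [hsplit]
  refine (eLpNorm_add_le (hmφ.sub (hmP.const_mul 6))
    (((hmf.sub hmP).const_smul _).add ((hmf.sub hmw).const_smul _)) le_rfl).trans ?_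
  refine add_le_add le_rfl ((eLpNorm_add_le ((hmf.sub hmP).const_smul _)
    ((hmf.sub hmw).const_smul _) le_rfl).trans ?_)
  rw [eLpNorm_const_smul, eLpNorm_const_smul]
  have h6 : ‖(6 : ℝ)‖ₑ = ((6 : NNReal) : ℝ≥0∞) := by
    rw [Real.enorm_of_nonneg (by norm_num), ENNReal.ofReal, Real.toNNReal_ofNat]
  rw [enorm_neg, h6]
  exact add_le_add le_rfl (mul_le_mul_right (eLpNorm_mono_measure _ Measure.restrict_le_self) _)

theorem clusterPointsBinary_of_energyMix_le {ε : ℕ → ℝ}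
    (hε : ∀ n, 0 < ε n) (hε0 : Tendsto ε atTop (𝓝 0)) {φ : ℕ → H10 Ω ℝ} {M : ℝ}
    (hM : ∀ n, energyMix (ε n) (φ n) ≤ ENNReal.ofReal M) :
    ClusterPointsBinary Ω fun n => fn (φ n) := by
  rintro k hk u ⟨hu, hlim⟩
  obtain ⟨a, ha, hae⟩ := (tendstoInMeasure_of_tendsto_eLpNorm one_ne_zero
    (fun n => aestronglyMeasurable_fn (φ (k n))) hu.1 hlim).exists_seq_tendsto_ae
  have hW : Tendsto (fun n => eLpNorm ((fun x => W (fn (φ (k (a n))) x)) - fun _ => 0) 1 (vol Ω))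
      atTop (𝓝 0) := by
    have h := (ENNReal.Tendsto.mul_const (ENNReal.tendsto_ofReal hε0)
      (Or.inr (ENNReal.ofReal_ne_top (r := M)))).comp (hk.comp ha).tendsto_atTop
    rw [ENNReal.ofReal_zero, zero_mul] at h
    refine tendsto_of_tendsto_of_tendsto_of_le_of_le tendsto_const_nhds h
      (fun _ => zero_le) fun n => ?_
    rw [eLpNorm_one_eq_lintegral_enorm]
    simp only [Pi.sub_apply, sub_zero, Real.enorm_of_nonneg (W_nonneg _)]
    exact (lintegral_W_le (hε _) _).trans (mul_le_mul_right (hM _) _)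
  obtain ⟨b, hb, hbe⟩ := (tendstoInMeasure_of_tendsto_eLpNorm one_ne_zero
    (fun n => continuous_W.comp_aestronglyMeasurable (aestronglyMeasurable_fn (φ (k (a n)))))
    aestronglyMeasurable_const hW).exists_seq_tendsto_ae
  filter_upwards [hae, hbe] with x h1 h2
  exact W_eq_zero_iff.1 (tendsto_nhds_unique
    (((continuous_W.tendsto _).comp h1).comp hb.tendsto_atTop) h2)

end PhaseField

/-! ### Weak-`*` compactness of vector measures -/

section DensityIntegral

variable {α : Type*} {m : MeasurableSpace α} {F : Type*} [NormedAddCommGroup F] [NormedSpace ℝ F]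
  {ρ : Measure α} {h : α → F}

lemma variation_withDensityᵥ_le (hh : Integrable h ρ) :
    (ρ.withDensityᵥ h).variation ≤ ρ.withDensity fun x => ‖h x‖ₑ := by
  refine VectorMeasure.variation_le_of_forall_enorm_le fun s hs => ?_
  rw [withDensityᵥ_apply hh hs, withDensity_apply _ hs]
  exact enorm_integral_le_lintegral_enorm _

lemma isFiniteMeasure_variation_withDensityᵥ (hh : Integrable h ρ) :
    IsFiniteMeasure (ρ.withDensityᵥ h).variation := by
  have : IsFiniteMeasure (ρ.withDensity fun x => ‖h x‖ₑ) := isFiniteMeasure_withDensity hh.2.ne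
  exact isFiniteMeasure_of_le _ (variation_withDensityᵥ_le hh)

/-- Integrating a bounded function against `h ρ` amounts to integrating `f h` against `ρ`. -/
lemma integral_withDensityᵥ_eq [CompleteSpace F] (hh : Integrable h ρ) {f : α → ℝ}
    (hf : StronglyMeasurable f) {C : ℝ} (hC : ∀ x, ‖f x‖ ≤ C) :
    ∫ᵛ x, f x ∂•(ρ.withDensityᵥ h) = ∫ x, f x • h x ∂ρ := by
  have hfin := isFiniteMeasure_variation_withDensityᵥ hh
  have hsimple : ∀ g : SimpleFunc α ℝ,
      ∫ᵛ x, g x ∂•(ρ.withDensityᵥ h) = ∫ x, g x • h x ∂ρ := fun g => by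
    have hint : ∀ g : SimpleFunc α ℝ, Integrable (fun x => g x • h x) ρ := fun g => by
      obtain ⟨c, hc⟩ := g.exists_forall_norm_le
      exact hh.bdd_smul c g.aestronglyMeasurable (Eventually.of_forall hc)
    induction g using SimpleFunc.induction with
    | const c hs =>
      rename_i s
      have h1 : ⇑((SimpleFunc.const α c).piecewise s hs (SimpleFunc.const α 0))
          = s.indicator fun _ => c := by
        ext x
        by_cases hx : x ∈ s <;> simp [hx]
      simp only [h1]
      rw [VectorMeasure.integral_indicator_const c hs, withDensityᵥ_apply hh hs,
        ← integral_indicator hs, ContinuousLinearMap.lsmul_apply, ← integral_smul]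
      congr 1
      ext x
      by_cases hx : x ∈ s <;> simp [hx]
    | add _ hf hg =>
      rename_i f g _
      have := VectorMeasure.integral_add (μ := ρ.withDensityᵥ h)
        (B := ContinuousLinearMap.lsmul ℝ ℝ) (f := f) (g := g)
        (f.integrable_of_isFiniteMeasure) (g.integrable_of_isFiniteMeasure)
      simp only [SimpleFunc.coe_add, Pi.add_apply] at this ⊢
      rw [this, hf, hg, ← integral_add (hint f) (hint g)]
      simp only [add_smul]
  have hC0 : ∀ x : α, 0 ≤ C := fun x => (norm_nonneg _).trans (hC x)
  refine tendsto_nhds_unique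
    (VectorMeasure.tendsto_integral_of_dominated_convergence (fun _ => C)
      (fun n => (hf.approxBounded C n).aestronglyMeasurable) (integrable_const C)
      (fun n => Eventually.of_forall fun x => hf.norm_approxBounded_le (hC0 x) n x)
      (Eventually.of_forall fun x => hf.tendsto_approxBounded_of_norm_le (hC x))) ?_
  simp only [hsimple]
  refine tendsto_integral_of_dominated_convergence (fun x => C * ‖h x‖)
    (fun n => (hf.approxBounded C n).aestronglyMeasurable.smul hh.1) (hh.norm.const_mul C)
    (fun n => Eventually.of_forall fun x => ?_)
    (Eventually.of_forall fun x => (hf.tendsto_approxBounded_of_norm_le (hC x)).smul_const _)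
  rw [norm_smul]
  gcongr
  exact hf.norm_approxBounded_le (hC0 x) n x

end DensityIntegral

section WeakStar

open scoped BoundedContinuousFunction

/-- A sequence of finite families of positive measures of bounded mass on a compact set has a weakly
convergent subsequence, as far as test functions vanishing at a given point `x₀` are concerned. The
point `x₀` serves to complete each measure to a multiple of a probability measure. -/
lemma exists_subseq_tendsto_measure {ι : Type*} [Finite ι] (μ : ℕ → ι → Measure E3) {K : Set E3}
    (hK : IsCompact K) {C : NNReal} (hC : ∀ n i, μ n i Set.univ ≤ C) (hμ : ∀ n i, μ n i Kᶜ = 0)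
    (x₀ : E3) : ∃ k : ℕ → ℕ, StrictMono k ∧ ∃ ν : ι → Measure E3, (∀ i, IsFiniteMeasure (ν i)) ∧
      ∀ i (f : E3 →ᵇ ℝ), f x₀ = 0 →
        Tendsto (fun n => ∫ x, f x ∂(μ (k n) i)) atTop (𝓝 (∫ x, f x ∂(ν i))) := by
  set c : NNReal := C + 1
  have hc : (c : ℝ≥0∞) ≠ 0 := by simp [c]
  have hc' : (c : ℝ≥0∞) ≠ ⊤ := ENNReal.coe_ne_top
  have hle : ∀ n i, μ n i Set.univ ≤ c := fun n i =>
    (hC n i).trans (by exact_mod_cast le_self_add)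
  have hfin : ∀ n i, IsFiniteMeasure (μ n i) := fun n i =>
    ⟨(hC n i).trans_lt ENNReal.coe_lt_top⟩
  set P' : ℕ → ι → Measure E3 := fun n i =>
    (c : ℝ≥0∞)⁻¹ • (μ n i + (c - μ n i Set.univ) • Measure.dirac x₀)
  have hP' : ∀ n i, IsProbabilityMeasure (P' n i) := fun n i => ⟨by
    simp only [P', Measure.smul_apply, Measure.add_apply, smul_eq_mul, measure_univ, mul_one]
    rw [add_tsub_cancel_of_le (hle n i), ENNReal.inv_mul_cancel hc hc']⟩
  set P : ℕ → ι → ProbabilityMeasure E3 := fun n i => ⟨P' n i, hP' n i⟩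
  have hK' : IsCompact (insert x₀ K) := hK.insert x₀
  have hS := isCompact_univ_pi fun _ : ι =>
    isCompact_setOfPred_probabilityMeasure_mass_eq_compl_isCompact_le (u := fun _ => 0)
      (K := fun _ : ℕ => insert x₀ K) tendsto_const_nhds (fun _ => hK') (Or.inl inferInstance)
  have hPS : ∀ n, P n ∈ Set.univ.pi fun _ : ι =>
      {p : ProbabilityMeasure E3 | ∀ _ : ℕ, p (insert x₀ K)ᶜ ≤ 0} := fun n i _ _ => by
    rw [nonpos_iff_eq_zero, ProbabilityMeasure.null_iff_toMeasure_null]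
    have h1 : μ n i (insert x₀ K)ᶜ = 0 :=
      measure_mono_null (Set.compl_subset_compl.2 (Set.subset_insert x₀ K)) (hμ n i)
    have h2 : Measure.dirac x₀ (insert x₀ K)ᶜ = 0 := by
      rw [Measure.dirac_apply' _ hK'.isClosed.measurableSet.compl]
      simp
    simp only [P, P', ProbabilityMeasure.coe_mk, Measure.smul_apply, Measure.add_apply, h1, h2,
      smul_eq_mul, mul_zero, add_zero]
  obtain ⟨p, -, k, hk, hlim⟩ := hS.isSeqCompact hPS
  refine ⟨k, hk, fun i => c • (p i : Measure E3), fun i => inferInstance, fun i f hf => ?_⟩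
  have h := ((ProbabilityMeasure.tendsto_iff_forall_integral_tendsto.1
    (tendsto_pi_nhds.1 hlim i)) f).const_mul (c : ℝ)
  rw [integral_smul_nnreal_measure]
  refine h.congr fun n => ?_
  have hi1 : Integrable f (μ (k n) i) := f.integrable _
  have hi2 : Integrable f ((c - μ (k n) i Set.univ) • Measure.dirac x₀) :=
    (f.integrable _).smul_measure (by finiteness)
  change (c : ℝ) * ∫ x, f x ∂((c : ℝ≥0∞)⁻¹ • (μ (k n) i + (c - μ (k n) i Set.univ) •
    Measure.dirac x₀)) = _
  rw [integral_smul_measure, integral_add_measure hi1 hi2, integral_smul_measure, integral_dirac,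
    hf, smul_zero, add_zero, smul_eq_mul, ENNReal.toReal_inv, ENNReal.coe_toReal,
    mul_inv_cancel_left₀]
  simpa using hc

variable {Ω : Opens E3}

/-- The positive or the negative part of the `k`-th coordinate of a vector field. -/
noncomputable def coordPart (g : E3 → E3) (i : Fin 3 × Bool) (x : E3) : ℝ≥0∞ :=
  ENNReal.ofReal (if i.2 then g x i.1 else -g x i.1)

lemma coordPart_le (g : E3 → E3) (i : Fin 3 × Bool) (x : E3) : coordPart g i x ≤ ‖g x‖ₑ := by
  rw [← ofReal_norm]
  refine ENNReal.ofReal_le_ofReal ?_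
  have h : |g x i.1| ≤ ‖g x‖ := PiLp.norm_apply_le (g x) i.1
  split_ifs
  · exact (le_abs_self _).trans h
  · exact (neg_le_abs _).trans h

lemma coordPart_toReal_sub (g : E3 → E3) (k : Fin 3) (x : E3) :
    (coordPart g (k, true) x).toReal - (coordPart g (k, false) x).toReal = g x k := by
  simp only [coordPart, ENNReal.toReal_ofReal', if_true, Bool.false_eq_true, if_false]
  rcases le_total 0 (g x k) with h | h
  · rw [max_eq_left h, max_eq_right (by linarith), sub_zero]
  · rw [max_eq_right h, max_eq_left (by linarith)]
    ring

lemma integral_smul_apply {μ : Measure E3} {f : E3 → ℝ} {g : E3 → E3}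
    (h : Integrable (fun x => f x • g x) μ) (k : Fin 3) :
    (∫ x, f x • g x ∂μ) k = ∫ x, f x * g x k ∂μ := by
  rw [eval_integral_piLp fun i => h.eval_piLp i]
  rfl

lemma aemeasurable_coordPart {μ : Measure E3} {g : E3 → E3} (hg : Integrable g μ)
    (i : Fin 3 × Bool) : AEMeasurable (coordPart g i) μ := by
  have h := (hg.eval_piLp i.1).1.aemeasurable
  unfold coordPart
  split_ifs
  · exact h.ennreal_ofReal
  · exact h.neg.ennreal_ofReal

lemma integral_mul_eq_sub_coordPart {μ : Measure E3} {g : E3 → E3} (hg : Integrable g μ)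
    {f : E3 → ℝ} (hf : StronglyMeasurable f) {C : ℝ} (hC : ∀ x, ‖f x‖ ≤ C) (k : Fin 3) :
    ∫ x, f x * g x k ∂μ = (∫ x, f x ∂(μ.withDensity (coordPart g (k, true))))
      - ∫ x, f x ∂(μ.withDensity (coordPart g (k, false))) := by
  have hm := aemeasurable_coordPart hg
  have hlt : ∀ i, ∀ᵐ x ∂μ, coordPart g i x < ⊤ := fun i =>
    Eventually.of_forall fun x => ENNReal.ofReal_lt_top
  have hint : ∀ i, Integrable (fun x => (coordPart g i x).toReal • f x) μ := fun i => by
    have h : Integrable (fun x => (coordPart g i x).toReal) μ :=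
      integrable_toReal_of_lintegral_ne_top (hm i)
        ((lintegral_mono (coordPart_le g i)).trans_lt hg.2).ne
    exact h.mul_bdd hf.aestronglyMeasurable (Eventually.of_forall hC)
  rw [integral_withDensity_eq_integral_toReal_smul₀ (hm _) (hlt _),
    integral_withDensity_eq_integral_toReal_smul₀ (hm _) (hlt _), ← integral_sub (hint _) (hint _)]
  refine integral_congr_ae (Eventually.of_forall fun x => ?_)
  simp only [smul_eq_mul]
  rw [← sub_mul, coordPart_toReal_sub, mul_comm]

/-- A family of positive finite measures, one for the positive and one for the negative part of each
coordinate, assembles to a vector measure of finite variation. -/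
lemma exists_vectorMeasure_integral_eq (m : Fin 3 × Bool → Measure E3)
    (hm : ∀ i, IsFiniteMeasure (m i)) : ∃ ν : VectorMeasure E3 E3,
      IsFiniteMeasure ν.variation ∧ (∀ s, MeasurableSet s → (∀ i, m i sᶜ = 0) →
        ν.restrict s = ν) ∧
      ∀ f : E3 → ℝ, StronglyMeasurable f → ∀ C, (∀ x, ‖f x‖ ≤ C) →
        ∫ᵛ x, f x ∂•ν = WithLp.toLp 2 fun k =>
          (∫ x, f x ∂(m (k, true))) - ∫ x, f x ∂(m (k, false)) := by
  set ρ : Measure E3 := ∑ i, m i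
  have hac : ∀ i, m i ≪ ρ := fun i => Measure.AbsolutelyContinuous.mk fun s _ hs => by
    rw [Measure.finsetSum_apply] at hs
    exact (Finset.sum_eq_zero_iff.1 hs) i (Finset.mem_univ i)
  set h : E3 → E3 := fun x => WithLp.toLp 2 fun k =>
    ((m (k, true)).rnDeriv ρ x).toReal - ((m (k, false)).rnDeriv ρ x).toReal
  have hh : Integrable h ρ := by
    refine Integrable.of_eval_piLp fun k => ?_
    exact Measure.integrable_toReal_rnDeriv.sub Measure.integrable_toReal_rnDeriv
  refine ⟨ρ.withDensityᵥ h, isFiniteMeasure_variation_withDensityᵥ hh, fun s hs hms => ?_,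
    fun f hf C hC => ?_⟩
  · ext1 t ht
    have hρ : ρ sᶜ = 0 := by
      rw [Measure.finsetSum_apply]
      exact Finset.sum_eq_zero fun i _ => hms i
    rw [VectorMeasure.restrict_apply _ hs ht, withDensityᵥ_apply hh (ht.inter hs),
      withDensityᵥ_apply hh ht]
    refine setIntegral_congr_set ?_
    have : s =ᵐ[ρ] Set.univ := ae_eq_univ.2 hρ
    simpa using! (ae_eq_refl t).inter this
  · rw [integral_withDensityᵥ_eq hh hf hC]
    have hi : Integrable (fun x => f x • h x) ρ :=
      hh.bdd_smul C hf.aestronglyMeasurable (Eventually.of_forall hC)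
    ext k
    rw [integral_smul_apply hi]
    have hd : ∀ i, Integrable (fun x => ((m i).rnDeriv ρ x).toReal • f x) ρ := fun i =>
      Measure.integrable_toReal_rnDeriv.mul_bdd hf.aestronglyMeasurable (Eventually.of_forall hC)
    have hρ : IsFiniteMeasure ρ := inferInstance
    have hld : ∀ i, (m i).HaveLebesgueDecomposition ρ := fun i =>
      Measure.haveLebesgueDecomposition_of_sigmaFinite (m i) ρ
    change _ = (∫ x, f x ∂(m (k, true))) - ∫ x, f x ∂(m (k, false))
    rw [← integral_rnDeriv_smul (hac (k, true)), ← integral_rnDeriv_smul (hac (k, false))]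
    rw [← integral_sub (hd _) (hd _)]
    refine integral_congr_ae (Eventually.of_forall fun x => ?_)
    simp only [h, smul_eq_mul]
    ring

/-- A bounded sequence in `L¹(Ω; ℝ³)` is weak-`*` precompact as a sequence of measures. -/
theorem weakStarPrecompact_of_lintegral_le (hΩ : Bornology.IsBounded (Ω : Set E3))
    {g : ℕ → E3 → E3} (hg : ∀ n, Integrable (g n) (vol Ω)) {K : NNReal}
    (hK : ∀ n, ∫⁻ x, ‖g n x‖ₑ ∂(vol Ω) ≤ K) :
    WeakStarPrecompact Ω fun n => (vol Ω).withDensityᵥ (g n) := by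
  intro j hj
  obtain ⟨R, hR⟩ := hΩ.exists_norm_le
  obtain ⟨x₀, hx₀⟩ := NormedSpace.exists_lt_norm ℝ E3 R
  have hx₀Ω : x₀ ∉ (Ω : Set E3) := fun h => absurd (hR x₀ h) (not_le.2 hx₀)
  obtain ⟨k, hk, m, hm, hlim⟩ := exists_subseq_tendsto_measure
    (fun n (i : Fin 3 × Bool) => (vol Ω).withDensity (coordPart (g (j n)) i)) hΩ.isCompact_closure
    (C := K) (fun n i => by
      rw [withDensity_apply _ MeasurableSet.univ, setLIntegral_univ]
      exact (lintegral_mono (coordPart_le _ i)).trans (hK _))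
    (fun n i => withDensity_absolutelyContinuous _ _ (by
      rw [Measure.restrict_apply isClosed_closure.measurableSet.compl]
      refine measure_mono_null ?_ measure_empty
      rintro x ⟨h1, h2⟩
      exact h1 (subset_closure h2))) x₀
  obtain ⟨ν, hν, hres, hint⟩ := exists_vectorMeasure_integral_eq
    (fun i => (m i).restrict (Ω : Set E3)) (fun i => inferInstance)
  have hΩm : MeasurableSet (Ω : Set E3) := Ω.isOpen.measurableSet
  refine ⟨k, hk, ν, hν, hres _ hΩm fun i => by simp [Measure.restrict_apply hΩm.compl],
    fun f hf hfc hfs => ?_⟩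
  obtain ⟨C, hC⟩ := hfc.exists_bound_of_continuous hf
  have hfm := hf.stronglyMeasurable
  have hfx : f x₀ = 0 := image_eq_zero_of_notMem_tsupport fun h => hx₀Ω (hfs h)
  have hres' : ∀ i, ∫ x, f x ∂((m i).restrict (Ω : Set E3)) = ∫ x, f x ∂(m i) := fun i =>
    setIntegral_eq_integral_of_forall_compl_eq_zero fun x hx =>
      image_eq_zero_of_notMem_tsupport fun h => hx (hfs h)
  rw [hint f hfm C hC]
  simp only [hres']
  have hn : ∀ n, ∫ᵛ x, f x ∂•((vol Ω).withDensityᵥ (g (j (k n)))) = WithLp.toLp 2 fun i =>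
      (∫ x, f x ∂((vol Ω).withDensity (coordPart (g (j (k n))) (i, true))))
        - ∫ x, f x ∂((vol Ω).withDensity (coordPart (g (j (k n))) (i, false))) := fun n => by
    rw [integral_withDensityᵥ_eq (hg _) hfm hC]
    ext i
    rw [integral_smul_apply ((hg _).bdd_smul C hfm.aestronglyMeasurable (Eventually.of_forall hC)),
      integral_mul_eq_sub_coordPart (hg _) hfm hC]
  simp only [hn]
  set f' : E3 →ᵇ ℝ := BoundedContinuousFunction.ofNormedAddCommGroup f hf C hC
  exact ((PiLp.continuous_toLp 2 fun _ : Fin 3 => ℝ).tendsto _).comp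
    (tendsto_pi_nhds.2 fun i => (hlim (i, true) f' hfx).sub (hlim (i, false) f' hfx))

end WeakStar

/-! ### Weak compactness of bounded sequences in a Hilbert space -/

/-- The Banach-Alaoglu theorem in the dual space, transported by the Riesz isomorphism. -/
lemma exists_subseq_tendsto_toWeakSpace {H : Type*} [NormedAddCommGroup H]
    [InnerProductSpace ℝ H] [CompleteSpace H] [SeparableSpace H] {x : ℕ → H} {C : ℝ}
    (hC : ∀ n, ‖x n‖ ≤ C) : ∃ k : ℕ → ℕ, StrictMono k ∧ ∃ y : H,
      Tendsto (fun n => toWeakSpace ℝ H (x (k n))) atTop (𝓝 (toWeakSpace ℝ H y)) := by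
  obtain ⟨ψ, -, k, hk, hlim⟩ := WeakDual.isSeqCompact_closedBall ℝ H 0 C
    (x := fun n => StrongDual.toWeakDual (InnerProductSpace.toDual ℝ H (x n)))
    (fun n => by simpa using! hC n)
  refine ⟨k, hk, (InnerProductSpace.toDual ℝ H).symm (WeakDual.toStrongDual ψ), ?_⟩
  refine (WeakBilin.tendsto_iff_forall_eval_tendsto _
    (fun a b h => ?_)).2 fun l => ?_
  · by_contra hab
    obtain ⟨l, hl⟩ := SeparatingDual.exists_separating_of_ne (R := ℝ) hab
    exact hl (by simpa using! DFunLike.congr_fun h l)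
  · obtain ⟨z, rfl⟩ := (InnerProductSpace.toDual ℝ H).surjective l
    have h := ((WeakDual.eval_continuous z).tendsto ψ).comp hlim
    have e1 : ∀ y : H, topDualPairing ℝ H (InnerProductSpace.toDual ℝ H z) y
        = InnerProductSpace.toDual ℝ H y z := fun y => by
      simp [topDualPairing_apply, InnerProductSpace.toDual_apply_apply, real_inner_comm]
    have e2 : ∀ y : H, (topDualPairing ℝ H).flip y (InnerProductSpace.toDual ℝ H z)
        = InnerProductSpace.toDual ℝ H y z := e1
    convert h using 2
    · exact e2 _
    · exact (e2 _).trans (DFunLike.congr_fun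
        ((InnerProductSpace.toDual ℝ H).apply_symm_apply (WeakDual.toStrongDual ψ)) z)

section Sobolev

variable {Ω : Opens E3} {V : Type} [NormedAddCommGroup V] [InnerProductSpace ℝ V]

lemma norm_sq_eq (u : H10 Ω V) :
    ‖u‖ ^ 2 = ∫ x, ‖fn u x‖ ^ 2 ∂(vol Ω) + ∫ x, ‖wgrad u x‖ ^ 2 ∂(vol Ω) := by
  change ‖(u : PairSpace Ω V)‖ ^ 2 = _
  rw [WithLp.prod_norm_sq_eq_of_L2, ← real_inner_self_eq_norm_sq,
    ← real_inner_self_eq_norm_sq, L2.inner_def, L2.inner_def]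
  simp only [real_inner_self_eq_norm_sq]
  rfl

lemma integrable_norm_fn_sq (u : H10 Ω V) : Integrable (fun x => ‖fn u x‖ ^ 2) (vol Ω) :=
  (memLp_fn u).integrable_norm_pow two_ne_zero

lemma integrable_norm_wgrad_sq (u : H10 Ω V) : Integrable (fun x => ‖wgrad u x‖ ^ 2) (vol Ω) :=
  (memLp_wgrad u).integrable_norm_pow two_ne_zero

/-- The space `H₀¹` is a separable Hilbert space, so that its bounded sequences are weakly
precompact. -/
lemma weaklyPrecompact_of_integral_le [FiniteDimensional ℝ V] {u : ℕ → H10 Ω V} {M : ℝ}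
    (hM : ∀ n, ∫ x, ‖fn (u n) x‖ ^ 2 ∂(vol Ω) + ∫ x, ‖wgrad (u n) x‖ ^ 2 ∂(vol Ω) ≤ M) :
    WeaklyPrecompact Ω u := by
  intro j _
  have : CompleteSpace V := FiniteDimensional.complete ℝ V
  have : ProperSpace V := FiniteDimensional.proper ℝ V
  have : SecondCountableTopology V := secondCountable_of_proper
  have : Fact ((2 : ℝ≥0∞) ≠ ⊤) := ⟨ENNReal.ofNat_ne_top⟩
  have : SecondCountableTopology (Lp V 2 (vol Ω)) := inferInstance
  have : SecondCountableTopology (Lp (Grad V) 2 (vol Ω)) := inferInstance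
  have : SecondCountableTopology (PairSpace Ω V) := inferInstance
  have : SeparableSpace (H10 Ω V) := inferInstance
  have : CompleteSpace (H10 Ω V) := (Submodule.isClosed_topologicalClosure _).completeSpace_coe
  exact exists_subseq_tendsto_toWeakSpace (C := √M) fun n =>
    Real.le_sqrt_of_sq_le ((norm_sq_eq _).trans_le (hM (j n)))

end Sobolev

/-! ### The Landau-de Gennes energy -/

variable {Ω : Opens E3}

lemma integrable_bulk (hΩ : Bornology.IsBounded (Ω : Set E3)) (A B C : ℝ) (u : H10 Ω S0) :
    Integrable (fun x => bulk A B C (fn u x)) (vol Ω) := by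
  have := isFiniteMeasure_vol hΩ
  obtain ⟨K, hK⟩ := exists_abs_bulk_le A B C
  have h4 : Integrable (fun x => ‖fn u x‖ ^ 4) (vol Ω) :=
    (memLp_four_fn hΩ u).integrable_norm_pow (p := 4) (by norm_num)
  exact (((integrable_const (1 : ℝ)).add h4).const_mul K).mono'
    ((continuous_bulk A B C).comp_aestronglyMeasurable (aestronglyMeasurable_fn u))
    (Eventually.of_forall fun x => hK _)

/-- Coercivity of the Landau-de Gennes energy. -/
lemma exists_le_energyLdG (hΩ : Bornology.IsBounded (Ω : Set E3)) (A B : ℝ) {C : ℝ} (hC : 0 < C)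
    (lam : ℝ) : ∃ D, 0 ≤ D ∧ ∀ u : H10 Ω S0,
      min (1 / 2) (lam ^ 2) * (∫ x, ‖fn u x‖ ^ 2 ∂(vol Ω) + ∫ x, ‖wgrad u x‖ ^ 2 ∂(vol Ω)) - D
        ≤ energyLdG A B C lam u := by
  have := isFiniteMeasure_vol hΩ
  obtain ⟨K, hK0, hK⟩ := exists_le_bulk A B hC
  refine ⟨lam ^ 2 * (K * (vol Ω).real Set.univ), by positivity, fun u => ?_⟩
  have h1 := integrable_norm_fn_sq u
  have h2 := integrable_norm_wgrad_sq u
  have h3 := integrable_bulk hΩ A B C u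
  have h4 : ∫ x, ‖fn u x‖ ^ 2 ∂(vol Ω) - K * (vol Ω).real Set.univ
      ≤ ∫ x, bulk A B C (fn u x) ∂(vol Ω) := by
    have h5 : ∫ x, (‖fn u x‖ ^ 2 - K) ∂(vol Ω)
        = ∫ x, ‖fn u x‖ ^ 2 ∂(vol Ω) - K * (vol Ω).real Set.univ := by
      rw [integral_sub h1 (integrable_const K), integral_const, smul_eq_mul, mul_comm]
    rw [← h5]
    exact integral_mono (h1.sub (integrable_const K)) h3 fun x => hK _
  rw [energyLdG, integral_add (h2.const_mul _) (h3.const_mul _), integral_const_mul,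
    integral_const_mul]
  have hn1 : 0 ≤ ∫ x, ‖fn u x‖ ^ 2 ∂(vol Ω) := integral_nonneg fun x => by positivity
  have hn2 : 0 ≤ ∫ x, ‖wgrad u x‖ ^ 2 ∂(vol Ω) := integral_nonneg fun x => by positivity
  have hm1 := mul_le_mul_of_nonneg_right (min_le_right (1 / 2) (lam ^ 2)) hn1
  have hm2 := mul_le_mul_of_nonneg_right (min_le_left (1 / 2) (lam ^ 2)) hn2
  have hm3 := mul_le_mul_of_nonneg_left h4 (sq_nonneg lam)
  linarith

theorem weaklyPrecompact_of_energyLdG_le (hΩ : Bornology.IsBounded (Ω : Set E3)) {A B C lam : ℝ}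
    (hC : 0 < C) (hlam : 0 < lam) {Q : ℕ → H10 Ω S0} {M : ℝ}
    (hM : ∀ n, energyLdG A B C lam (Q n) ≤ M) : WeaklyPrecompact Ω Q := by
  obtain ⟨D, -, hD⟩ := exists_le_energyLdG hΩ A B hC lam
  set c := min (1 / 2) (lam ^ 2)
  have hc : 0 < c := lt_min (by norm_num) (by positivity)
  refine weaklyPrecompact_of_integral_le (M := (M + D) / c) fun n => ?_
  rw [le_div_iff₀ hc, mul_comm]
  linarith [hD (Q n), hM n]

/-! ### The anchoring energy -/

lemma aestronglyMeasurable_matVec_gradPhi (Q : H10 Ω S0) (φ : H10 Ω ℝ) :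
    AEStronglyMeasurable (fun x => matVec (toMat (fn Q x)) (gradPhi φ x)) (vol Ω) :=
  continuous_matVec.comp_aestronglyMeasurable
    ((continuous_toMat.comp_aestronglyMeasurable (aestronglyMeasurable_fn Q)).prodMk
      (aestronglyMeasurable_gradPhi φ))

/-- The field `Q ∇Φ(φ)` is the sum of `√W(φ) (Q + s₊/3) ∇φ`, controlled by the anchoring and the
mixing energies through Young's inequality, and of a multiple of `∇Φ(φ)`. -/
lemma lintegral_matVec_gradPhi_le (A B C : ℝ) {ε : ℝ} (hε : 0 < ε) (Q : H10 Ω S0)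
    (φ : H10 Ω ℝ) :
    ∫⁻ x, ‖matVec (toMat (fn Q x)) (gradPhi φ x)‖ₑ ∂(vol Ω)
      ≤ energyAnch A B C ε Q φ + energyMix ε φ + ‖sPlus A B C / 3‖ₑ * energyMix ε φ := by
  set s := sPlus A B C / 3
  set T : E3 → E3 := fun x => matVec (toMat (fn Q x) + s • 1) (wgrad φ x)
  have hpt : ∀ x, ‖matVec (toMat (fn Q x)) (gradPhi φ x)‖ₑ
      ≤ (ENNReal.ofReal (ε * ‖T x‖ ^ 2)
        + ENNReal.ofReal (ε * ‖wgrad φ x‖ ^ 2 + ε⁻¹ * W (fn φ x))) + ‖s‖ₑ * ‖gradPhi φ x‖ₑ :=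
      fun x => by
    have hsplit : matVec (toMat (fn Q x)) (gradPhi φ x)
        = √(W (fn φ x)) • T x - s • gradPhi φ x := by
      simp only [T, gradPhi, matVec_add_smul_one, matVec_smul, smul_add]
      rw [smul_comm s, add_sub_cancel_right]
    rw [hsplit]
    refine enorm_sub_le.trans (add_le_add ?_ (enorm_smul _ _).le)
    have hW := W_nonneg (fn φ x)
    rw [← ENNReal.ofReal_add (by positivity) (by positivity), ← ofReal_norm]
    refine ENNReal.ofReal_le_ofReal ?_
    rw [norm_smul, Real.norm_of_nonneg (Real.sqrt_nonneg _)]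
    have h := Real.sq_sqrt hW
    set w := √(W (fn φ x))
    rw [← h]
    have h2 : ε * ‖T x‖ ^ 2 + ε⁻¹ * w ^ 2 - w * ‖T x‖
        = ε⁻¹ * ((ε * ‖T x‖ - w / 2) ^ 2 + 3 / 4 * w ^ 2) := by
      field_simp
      ring
    have : 0 ≤ ε⁻¹ * ((ε * ‖T x‖ - w / 2) ^ 2 + 3 / 4 * w ^ 2) := by positivity
    have : 0 ≤ ε * ‖wgrad φ x‖ ^ 2 := by positivity
    linarith
  have hT : AEStronglyMeasurable T (vol Ω) :=
    continuous_matVec.comp_aestronglyMeasurable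
      (((continuous_toMat.add continuous_const).comp_aestronglyMeasurable
        (aestronglyMeasurable_fn Q)).prodMk (aestronglyMeasurable_wgrad φ))
  have hTm : AEMeasurable (fun x => ENNReal.ofReal (ε * ‖T x‖ ^ 2)) (vol Ω) :=
    ((hT.norm.aemeasurable.pow_const 2).const_mul ε).ennreal_ofReal
  have hGm : AEMeasurable (fun x => ‖s‖ₑ * ‖gradPhi φ x‖ₑ) (vol Ω) :=
    (aestronglyMeasurable_gradPhi φ).enorm.const_mul _
  refine (lintegral_mono hpt).trans ?_
  rw [lintegral_add_right' _ hGm, lintegral_add_left' hTm,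
    lintegral_const_mul' _ _ enorm_ne_top]
  exact add_le_add le_rfl (mul_le_mul_right (lintegral_gradPhi_le_energyMix hε φ) _)

theorem gradPhiPrecompact_of_energy_le (hΩ : Bornology.IsBounded (Ω : Set E3)) {A B C : ℝ}
    {ε : ℕ → ℝ} (hε : ∀ n, 0 < ε n) {Q : ℕ → H10 Ω S0} {φ : ℕ → H10 Ω ℝ} {M M' : ℝ}
    (hM : ∀ n, energyMix (ε n) (φ n) ≤ ENNReal.ofReal M)
    (hM' : ∀ n, energyAnch A B C (ε n) (Q n) (φ n) ≤ ENNReal.ofReal M') :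
    GradPhiPrecompact Q φ := by
  have hG : ∀ n, ∫⁻ x, ‖gradPhi (φ n) x‖ₑ ∂(vol Ω) ≤ (M.toNNReal : ℝ≥0∞) := fun n =>
    (lintegral_gradPhi_le_energyMix (hε n) _).trans (hM n)
  have hQ : ∀ n, ∫⁻ x, ‖matVec (toMat (fn (Q n) x)) (gradPhi (φ n) x)‖ₑ ∂(vol Ω)
      ≤ ((M'.toNNReal + M.toNNReal + ‖sPlus A B C / 3‖₊ * M.toNNReal : NNReal) : ℝ≥0∞) :=
    fun n => by
      push_cast
      exact (lintegral_matVec_gradPhi_le A B C (hε n) _ _).trans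
        (add_le_add (add_le_add (hM' n) (hM n)) (mul_le_mul_right (hM n) _))
  have hGi := fun n => integrable_gradPhi hΩ (φ n)
  have hQi : ∀ n, Integrable (fun x => matVec (toMat (fn (Q n) x)) (gradPhi (φ n) x)) (vol Ω) :=
    fun n => ⟨aestronglyMeasurable_matVec_gradPhi _ _, (hQ n).trans_lt ENNReal.coe_lt_top⟩
  exact ⟨fun n => gradPhi (φ n), fun n => ⟨hasWeakGradient_gradPhi hΩ _, hGi n, hQi n⟩,
    weakStarPrecompact_of_lintegral_le hΩ hGi hG, weakStarPrecompact_of_lintegral_le hΩ hQi hQ⟩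

/-! ### Bounds from the total energy -/

lemma le_ofReal_div_of_mul_le {a b : ℝ} (ha : 0 < a) {x : ℝ≥0∞}
    (h : ENNReal.ofReal a * x ≤ ENNReal.ofReal b) : x ≤ ENNReal.ofReal (b / a) := by
  rw [ENNReal.ofReal_div_of_pos ha, ENNReal.le_div_iff_mul_le
    (Or.inl (ENNReal.ofReal_pos.2 ha).ne') (Or.inl ENNReal.ofReal_ne_top), mul_comm]
  exact h

/-- The other energies being nonnegative and the Landau-de Gennes energy being bounded below, a
bound on the total energy bounds each of its parts. -/
lemma exists_bounds_of_energy_le (hΩ : Bornology.IsBounded (Ω : Set E3))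
    {A B C lam ωp ωa ωv : ℝ} (hC : 0 < C) (hlam : 0 < lam) (hωp : 0 < ωp) (hωa : 0 < ωa)
    {ε : ℕ → ℝ} {Q : ℕ → H10 Ω S0} {φ : ℕ → H10 Ω ℝ} {M : ℝ}
    (hM : ∀ n, energy A B C lam ωp ωa ωv (ε n) (Q n) (φ n) ≤ (M : EReal)) :
    (∀ n, energyLdG A B C lam (Q n) ≤ M) ∧
    (∃ M', ∀ n, energyMix (ε n) (φ n) ≤ ENNReal.ofReal M') ∧
    ∃ M', ∀ n, energyAnch A B C (ε n) (Q n) (φ n) ≤ ENNReal.ofReal M' := by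
  obtain ⟨D, -, hD⟩ := exists_le_energyLdG hΩ A B hC lam
  have key : ∀ n, energyLdG A B C lam (Q n) ≤ M ∧
      ENNReal.ofReal (ωp * lam) * energyMix (ε n) (φ n)
      + ENNReal.ofReal (ωa * lam) * energyAnch A B C (ε n) (Q n) (φ n)
      + ENNReal.ofReal (ωv * lam ^ 2) * energyVoid (Q n) (φ n) ≤ ENNReal.ofReal (M + D) :=
      fun n => by
    have h := hM n
    rw [energy] at h
    generalize ENNReal.ofReal (ωp * lam) * energyMix (ε n) (φ n)
      + ENNReal.ofReal (ωa * lam) * energyAnch A B C (ε n) (Q n) (φ n)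
      + ENNReal.ofReal (ωv * lam ^ 2) * energyVoid (Q n) (φ n) = R at h ⊢
    induction R using ENNReal.recTopCoe with
    | top =>
      rw [EReal.coe_ennreal_top, EReal.coe_add_top, top_le_iff] at h
      exact absurd h (EReal.coe_ne_top M)
    | coe r =>
      have h' : energyLdG A B C lam (Q n) + r ≤ M := by
        have e : (((r : NNReal) : ℝ≥0∞) : EReal) = ((r : ℝ) : EReal) := rfl
        rw [e, ← EReal.coe_add, EReal.coe_le_coe_iff] at h
        exact h
      have hr := r.coe_nonneg
      have hQ : 0 ≤ min (1 / 2) (lam ^ 2) *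
          (∫ x, ‖fn (Q n) x‖ ^ 2 ∂(vol Ω) + ∫ x, ‖wgrad (Q n) x‖ ^ 2 ∂(vol Ω)) := by positivity
      refine ⟨by linarith, ?_⟩
      rw [← ENNReal.ofReal_coe_nnreal]
      exact ENNReal.ofReal_le_ofReal (by linarith [hD (Q n)])
  refine ⟨fun n => (key n).1, ⟨_, fun n => le_ofReal_div_of_mul_le (mul_pos hωp hlam)
    (le_trans ?_ (key n).2)⟩, ⟨_, fun n => le_ofReal_div_of_mul_le (mul_pos hωa hlam)
    (le_trans ?_ (key n).2)⟩⟩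
  · exact le_self_add.trans le_self_add
  · exact le_add_self.trans le_self_add

end LdG


theorem proposition5p3
    (Ω : TopologicalSpace.Opens LdG.E3) (hΩ : Bornology.IsBounded (Ω : Set LdG.E3))
    (A B C lam ωp ωa ωv : ℝ) (hA : A < 0) (hB : 0 < B) (hC : 0 < C)
    (hlam : 0 < lam) (hωp : 0 < ωp) (hωa : 0 < ωa) (hωv : 0 < ωv)
    (ε : ℕ → ℝ) (hε : ∀ n, 0 < ε n) (hε0 : Filter.Tendsto ε Filter.atTop (nhds 0))
    (Q : ℕ → LdG.H10 Ω LdG.S0) (φ : ℕ → LdG.H10 Ω ℝ) :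
    ((∃ M : ℝ, ∀ n, LdG.energyLdG A B C lam (Q n) ≤ M) →
      LdG.WeaklyPrecompact Ω Q) ∧
    ((∃ M : ℝ, ∀ n, LdG.energyMix (ε n) (φ n) ≤ ENNReal.ofReal M) →
      LdG.PrecompactL1 Ω (fun n => LdG.fn (φ n)) ∧
      LdG.ClusterPointsBinary Ω (fun n => LdG.fn (φ n))) ∧
    ((∃ M : ℝ, ∀ n, LdG.energyMix (ε n) (φ n) ≤ ENNReal.ofReal M) →
      (∃ M : ℝ, ∀ n, LdG.energyAnch A B C (ε n) (Q n) (φ n) ≤ ENNReal.ofReal M) →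
      LdG.GradPhiPrecompact Q φ) ∧
    ((∃ M : ℝ, ∀ n, LdG.energy A B C lam ωp ωa ωv (ε n) (Q n) (φ n) ≤ (M : EReal)) →
      LdG.WeaklyPrecompact Ω Q ∧
      LdG.PrecompactL1 Ω (fun n => LdG.fn (φ n)) ∧
      LdG.ClusterPointsBinary Ω (fun n => LdG.fn (φ n)) ∧
      LdG.GradPhiPrecompact Q φ) := by
  refine ⟨?_, ?_, ?_, ?_⟩
  · rintro ⟨M, hM⟩
    exact LdG.weaklyPrecompact_of_energyLdG_le hΩ hC hlam hM
  · rintro ⟨M, hM⟩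
    exact ⟨LdG.precompactL1_of_energyMix_le hΩ hε hε0 hM,
      LdG.clusterPointsBinary_of_energyMix_le hε hε0 hM⟩
  · rintro ⟨M, hM⟩ ⟨M', hM'⟩
    exact LdG.gradPhiPrecompact_of_energy_le hΩ hε hM hM'
  · rintro ⟨M, hM⟩
    obtain ⟨hLdG, ⟨M₁, h₁⟩, M₂, h₂⟩ := LdG.exists_bounds_of_energy_le hΩ hC hlam hωp hωa hM
    exact ⟨LdG.weaklyPrecompact_of_energyLdG_le hΩ hC hlam hLdG,
      LdG.precompactL1_of_energyMix_le hΩ hε hε0 h₁,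
      LdG.clusterPointsBinary_of_energyMix_le hε hε0 h₁,
      LdG.gradPhiPrecompact_of_energy_le hΩ hε h₁ h₂⟩
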